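/- Let $\mathcal A=[K]$ be a finite set of actions, $\mathcal X$ a measurable space of contexts, $\mathcal S$ a finite set of latent states, $P_1$ a probability distribution (prior) on $\mathcal S$, and let $P(\cdot\mid a,x,s,\theta)$, $\theta\in\Theta$, be conditional reward distributions on $\mathbb R$ (probability kernels in $(a,x,s)$) with means $\mu(a,x,s,\theta)$. Fix the true parameter $\theta_*\in\Theta$ and $\sigma\ge 0$. Assume that rewards are $\sigma^2$-sub-Gaussian, i.e. $\mathbb E_{R\sim P(\cdot\mid a,x,s,\theta_*)}[\exp(\lambda(R-\mu(a,x,s,\theta_*)))]\le\exp(\sigma^2\lambda^2/2)$ for all $a,x,s$ and all $\lambda\in\mathbb R$, and that the suboptimality of every action is at most $1$, i.e. $\max_{a'}\mu(a',x,s,\theta_*)-\mu(a,x,s,\theta_*)\le 1$ for all $a,x,s$. The latent state $S_*\sim P_1$ is drawn once. In round $t=1,2,\dots$, with history $H_t=(X_\ell,A_\ell,R_\ell)_{\ell<t}$, a context $X_t$ is generated by an arbitrary probability kernel from $H_t$ (so that $X_t$ is independent of $S_*$ given $H_t$), the agent chooses an action $A_t\in\mathcal A$, and the reward $R_t$ is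 drawn from $P(\cdot\mid A_t,X_t,S_*,\theta_*)$. The algorithm mTS with model parameter $\hat\theta$ computes the posterior $P_t(s)\propto P_1(s)\prod_{\ell<t}P(R_\ell\mid A_\ell,X_\ell,s,\hat\theta)$ (with $P(r\mid\cdot)$ denoting likelihoods, i.e. densities with respect to a common dominating measure), samples $B_t\sim P_t$ independently of everything else given $H_t$, and plays $A_t\in\arg\max_{a\in\mathcal A}\mu(a,X_t,B_t,\hat\theta)$, where ties are broken by a fixed measurable rule. Assume that the model is known exactly, $\hat\theta=\theta_*$. Then for every $\theta_*\in\Theta$ and every $n$, the $n$-round Bayes regret of mTS, $$\mathcal{BR}(n)=\mathbb E\Big[\sum_{t=1}^n\Big(\max_{a\in\mathcal A}\mu(a,X_t,S_*,\theta_*)-\mu(A_t,X_t,S_*,\theta_*)\Big)\Big],$$ is well defined (the sum is integrable) and satisfies $$\mathcal{BR}(n)\le 3|\mathcal S|+2\sigma\sqrt{6|\mathcal S|\,n\log n}.$$ -/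

import Mathlib

open MeasureTheory ProbabilityTheory
open scoped ENNReal NNReal

namespace LatentBandit

/-- The record of one round: the context `X_t`, the latent state `B_t` sampled by the agent,
the action `A_t` and the reward `R_t`. -/
abbrev Round (𝒳 𝒮 : Type*) (K : ℕ) := 𝒳 × 𝒮 × Fin K × ℝ

/-- The observation history `H_t`: the triples (context, action, reward) of `t` past rounds. -/
abbrev Hist (𝒳 : Type*) (K t : ℕ) := Fin t → 𝒳 × Fin K × ℝ

section

variable {𝒳 𝒮 Θ : Type*} {K : ℕ}

/-- The observation history contained in the records of `t` rounds (the sampled latent states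
`B_ℓ` are not part of it). -/
def obs {t : ℕ} (ω : Fin t → Round 𝒳 𝒮 K) : Hist 𝒳 K t :=
  fun i => ((ω i).1, (ω i).2.2.1, (ω i).2.2.2)

variable [MeasurableSpace 𝒳] [MeasurableSpace 𝒮]

lemma measurable_obs {t : ℕ} : Measurable (obs (𝒳 := 𝒳) (𝒮 := 𝒮) (K := K) (t := t)) := by
  unfold obs
  fun_prop

/-- The mean reward `μ(a, x, s, θ)` of a family `P` of conditional reward distributions. -/
noncomputable def meanReward (P : Θ → Kernel (Fin K × 𝒳 × 𝒮) ℝ) (a : Fin K) (x : 𝒳) (s : 𝒮)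
    (θ : Θ) : ℝ :=
  ∫ r, r ∂(P θ (a, x, s))

/-- The reward distributions under `θ` in a fixed latent state `s`. -/
noncomputable def stateKernel (P : Θ → Kernel (Fin K × 𝒳 × 𝒮) ℝ) (θ : Θ) (s : 𝒮) :
    Kernel (Fin K × 𝒳) ℝ :=
  (P θ).comap (fun q => (q.1, q.2, s)) (by fun_prop)

variable [Fintype 𝒮]

/-- The likelihood `P(r ∣ a, x, s, θ)`: the density of the reward distribution in state `s` with
respect to the measure `∑ s', P(· ∣ a, x, s', θ)`, which dominates all of them. (The posterior does
not depend on the choice of the dominating measure.) -/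
noncomputable def likelihood (P : Θ → Kernel (Fin K × 𝒳 × 𝒮) ℝ) (θ : Θ) (s : 𝒮)
    (o : 𝒳 × Fin K × ℝ) : ℝ≥0∞ :=
  Kernel.rnDeriv (stateKernel P θ s) (∑ s', stateKernel P θ s') (o.2.1, o.1) o.2.2

/-- The unnormalized posterior weight `P₁(s) ∏_ℓ P(R_ℓ ∣ A_ℓ, X_ℓ, s, θ)`. -/
noncomputable def weight (P : Θ → Kernel (Fin K × 𝒳 × 𝒮) ℝ) (θ : Θ) (P₁ : Measure 𝒮) {t : ℕ}
    (h : Hist 𝒳 K t) (s : 𝒮) : ℝ≥0∞ :=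
  P₁ {s} * ∏ i, likelihood P θ s (h i)

/-- The normalization constant of the posterior. -/
noncomputable def evidence (P : Θ → Kernel (Fin K × 𝒳 × 𝒮) ℝ) (θ : Θ) (P₁ : Measure 𝒮) {t : ℕ}
    (h : Hist 𝒳 K t) : ℝ≥0∞ :=
  ∑ s, weight P θ P₁ h s

open scoped Classical in
/-- The posterior `P_t(s) ∝ P₁(s) ∏_ℓ P(R_ℓ ∣ A_ℓ, X_ℓ, s, θ)` given the history. On the
histories for which the weights cannot be normalized it is set to the prior. -/
noncomputable def posteriorMeasure (P : Θ → Kernel (Fin K × 𝒳 × 𝒮) ℝ) (θ : Θ) (P₁ : Measure 𝒮)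
    {t : ℕ} (h : Hist 𝒳 K t) : Measure 𝒮 :=
  if evidence P θ P₁ h = 0 ∨ evidence P θ P₁ h = ∞ then P₁
  else ∑ s, (weight P θ P₁ h s / evidence P θ P₁ h) • Measure.dirac s

lemma measurable_weight (P : Θ → Kernel (Fin K × 𝒳 × 𝒮) ℝ) (θ : Θ) (P₁ : Measure 𝒮) {t : ℕ}
    (s : 𝒮) : Measurable (fun h : Hist 𝒳 K t => weight P θ P₁ h s) := by
  unfold weight likelihood
  refine Measurable.const_mul (Finset.measurable_prod _ fun i _ => ?_) _
  have hf : Measurable (fun q : Hist 𝒳 K t => (((q i).2.1, (q i).1), (q i).2.2)) := by fun_prop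
  exact (Kernel.measurable_rnDeriv (stateKernel P θ s) (∑ s', stateKernel P θ s')).comp hf

lemma measurable_evidence (P : Θ → Kernel (Fin K × 𝒳 × 𝒮) ℝ) (θ : Θ) (P₁ : Measure 𝒮) {t : ℕ} :
    Measurable (fun h : Hist 𝒳 K t => evidence P θ P₁ h) := by
  unfold evidence
  exact Finset.measurable_sum _ fun s _ => measurable_weight P θ P₁ s

lemma measurable_posteriorMeasure (P : Θ → Kernel (Fin K × 𝒳 × 𝒮) ℝ) (θ : Θ) (P₁ : Measure 𝒮)
    {t : ℕ} : Measurable (fun h : Hist 𝒳 K t => posteriorMeasure P θ P₁ h) := by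
  classical
  unfold posteriorMeasure
  have hE := measurable_evidence (t := t) P θ P₁
  refine Measurable.ite ?_ measurable_const ?_
  · exact (hE (measurableSet_singleton 0)).union (hE (measurableSet_singleton ∞))
  · refine Measure.measurable_of_measurable_coe _ fun A _ => ?_
    simp only [Measure.coe_finsetSum, Finset.sum_apply, Measure.smul_apply, smul_eq_mul]
    exact Finset.measurable_sum _ fun s _ =>
      ((measurable_weight P θ P₁ s).div hE).mul_const _

/-- The posterior as a Markov kernel from histories to latent states. -/
noncomputable def posteriorKernel (P : Θ → Kernel (Fin K × 𝒳 × 𝒮) ℝ) (θ : Θ) (P₁ : Measure 𝒮)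
    (t : ℕ) : Kernel (Hist 𝒳 K t) 𝒮 :=
  ⟨posteriorMeasure P θ P₁, measurable_posteriorMeasure P θ P₁⟩

instance (P : Θ → Kernel (Fin K × 𝒳 × 𝒮) ℝ) (θ : Θ) (P₁ : Measure 𝒮) [IsProbabilityMeasure P₁]
    (t : ℕ) : IsMarkovKernel (posteriorKernel P θ P₁ t) := by
  classical
  refine ⟨fun h => ⟨?_⟩⟩
  change posteriorMeasure P θ P₁ h Set.univ = 1
  unfold posteriorMeasure
  split_ifs with hz
  · exact measure_univ
  · push Not at hz
    simp only [Measure.coe_finsetSum, Finset.sum_apply, Measure.smul_apply, smul_eq_mul,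
      measure_univ, mul_one, ENNReal.div_eq_inv_mul]
    rw [← Finset.mul_sum]
    exact ENNReal.inv_mul_cancel hz.1 hz.2

/-- The context `X` of a round, drawn from `ctx t` given the history; the latent state has no
influence on it beyond the history. -/
noncomputable def contextStep {t : ℕ} (κ : Kernel (Hist 𝒳 K t) 𝒳) :
    Kernel (𝒮 × (Fin t → Round 𝒳 𝒮 K)) 𝒳 :=
  κ.comap (fun p => obs p.2) (measurable_obs.comp measurable_snd)

/-- The state `B` sampled by the agent, drawn from the posterior given the history. -/
noncomputable def sampleStep (P : Θ → Kernel (Fin K × 𝒳 × 𝒮) ℝ) (θhat : Θ) (P₁ : Measure 𝒮)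
    (t : ℕ) : Kernel ((𝒮 × (Fin t → Round 𝒳 𝒮 K)) × 𝒳) 𝒮 :=
  (posteriorKernel P θhat P₁ t).comap (fun p => obs p.1.2)
    (measurable_obs.comp (measurable_snd.comp measurable_fst))

/-- The reward, drawn from `P(· ∣ A, X, s, θstar)` with `A = select X B` and `s` the latent
state. -/
noncomputable def rewardStep (P : Θ → Kernel (Fin K × 𝒳 × 𝒮) ℝ) (θstar : Θ)
    (select : 𝒳 → 𝒮 → Fin K) (hselect : Measurable (Function.uncurry select)) (t : ℕ) :
    Kernel ((𝒮 × (Fin t → Round 𝒳 𝒮 K)) × 𝒳 × 𝒮) ℝ :=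
  (P θstar).comap (fun p => (select p.2.1 p.2.2, p.2.1, p.1.1))
    ((hselect.comp measurable_snd).prodMk
      ((measurable_fst.comp measurable_snd).prodMk (measurable_fst.comp measurable_fst)))

/-- One round of the interaction of `mTS` (run with the model parameter `θhat`, the prior `P₁` and
the maximizing action `select x b` in context `x` and sampled state `b`) with the environment (true
parameter `θstar`), given the latent state and the records of the past rounds: the context `X`, the
sampled state `B`, the action `A = select X B` and the reward `R`. -/
noncomputable def stepKernel (P : Θ → Kernel (Fin K × 𝒳 × 𝒮) ℝ) (θstar θhat : Θ)
    (P₁ : Measure 𝒮) (ctx : (t : ℕ) → Kernel (Hist 𝒳 K t) 𝒳)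
    (select : 𝒳 → 𝒮 → Fin K) (hselect : Measurable (Function.uncurry select)) (t : ℕ) :
    Kernel (𝒮 × (Fin t → Round 𝒳 𝒮 K)) (Round 𝒳 𝒮 K) :=
  ((contextStep (ctx t) ⊗ₖ sampleStep P θhat P₁ t) ⊗ₖ
    rewardStep P θstar select hselect t).map
    (fun q => (q.1.1, q.1.2, select q.1.1 q.1.2, q.2))

/-- The joint law of the latent state `S_* ∼ P₁` and of the records of the first `t` rounds. -/
noncomputable def law (P : Θ → Kernel (Fin K × 𝒳 × 𝒮) ℝ) (θstar θhat : Θ)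
    (P₁ : Measure 𝒮) (ctx : (t : ℕ) → Kernel (Hist 𝒳 K t) 𝒳)
    (select : 𝒳 → 𝒮 → Fin K) (hselect : Measurable (Function.uncurry select)) :
    (t : ℕ) → Measure (𝒮 × (Fin t → Round 𝒳 𝒮 K))
  | 0 => P₁.map (fun s => (s, Fin.elim0))
  | t + 1 =>
    ((law P θstar θhat P₁ ctx select hselect t) ⊗ₘ
      (stepKernel P θstar θhat P₁ ctx select hselect t)).map
      (fun q => (q.1.1, Fin.snoc (α := fun _ => Round 𝒳 𝒮 K) q.1.2 q.2))

/-- The regret accumulated over `n` rounds when the latent state is `p.1` and the records of the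
rounds are `p.2`: the sum over the rounds of `max_a μ(a, X_t, s, θ) - μ(A_t, X_t, s, θ)`. -/
noncomputable def totalRegret (P : Θ → Kernel (Fin K × 𝒳 × 𝒮) ℝ) (θ : Θ) {n : ℕ}
    (p : 𝒮 × (Fin n → Round 𝒳 𝒮 K)) : ℝ :=
  ∑ t, ((⨆ a, meanReward P a (p.2 t).1 p.1 θ) - meanReward P (p.2 t).2.2.1 (p.2 t).1 p.1 θ)

/-- The `n`-round Bayes regret of `mTS`. -/
noncomputable def bayesRegret (P : Θ → Kernel (Fin K × 𝒳 × 𝒮) ℝ) (θstar θhat : Θ)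
    (P₁ : Measure 𝒮) (ctx : (t : ℕ) → Kernel (Hist 𝒳 K t) 𝒳)
    (select : 𝒳 → 𝒮 → Fin K) (hselect : Measurable (Function.uncurry select)) (n : ℕ) : ℝ :=
  ∫ p, totalRegret P θstar p ∂(law P θstar θhat P₁ ctx select hselect n)

end

end LatentBandit

/-! ### One round: real inequalities for posterior sampling -/

namespace LatentBandit

/-! Given the history, the latent state `s` and the sampled state `b` are independent draws from the
same posterior `p`. Symmetrising in `(s, b)` therefore bounds the conditional regret of a round by
the average of a clipped gap: how much higher the mean of the action `sel b`, played when `b` is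
sampled, is in state `b` than in state `s`. If this gap is large, the rewards of `sel b` tell `s`
and `b` apart: by Hölder and the sub-Gaussian bound (`lintegral_rpow_mul_rpow_le`) the affinity `∫
f_s ^ (1 - α) * f_b ^ α` is at most `exp (-(gap / A - V / A ^ 2))` for every `A > 0`, where `V = σ ^
2 / (2 * α * (1 - α))`.

This separation is paid for by the potential `∑ s b, p s ^ (1 - α) * p b ^ α`. Playing an action
multiplies its `(s, b)` term, in mean, by the affinity of `s` and `b` under that action, so the
potential never increases in mean; it starts at no more than `|𝒮|` and stays nonnegative.
`posterior_sampling_step` bounds the regret of a round by `exp τ * (2 + A)` times the mean decrease,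
plus `V / A + 2 * exp (-(τ / α)) * (|𝒮| - 1)`, where the last term pays for the pairs with `p b` far
below `p s`. Summing over rounds telescopes (`lintegral_totalRegret_add_potential_le`).

With `τ = 1 / 4` and `α = 1 / (8 * log n)` the exponential is `n ^ (-2)` and `V` is of order `σ ^ 2
* log n`; optimising `A` gives the bound.

Conditioning is handled by a change of measure: the joint law has density `weight` with respect to a
reference law (`lintegral_law`). The potential is homogeneous of degree one, so it can be evaluated
at the unnormalised weights, which evolve by multiplication. -/

lemma min_gap_le {x A B bc : ℝ} (w : ℝ) (hA : 0 < A) (hB : 0 ≤ B) (hx : x ≤ 2)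
    (hbc0 : 0 ≤ bc) (hbc1 : bc ≤ 1) (hbc : bc ≤ Real.exp (-w)) (hw : x ≤ A * w + B) :
    x ≤ (2 + A) * (1 - bc) + B := by
  -- This gives `bc * w ≤ 1 - bc`. Then `x = (1 - bc) * x + bc * x`, with `x ≤ 2` used in the first
  -- term and `x ≤ A * w + B` in the second.
  have h1 : bc * (1 + w) ≤ 1 := by
    have h2 : bc * Real.exp w ≤ 1 := by
      calc bc * Real.exp w ≤ Real.exp (-w) * Real.exp w := by gcongr
        _ = 1 := by rw [← Real.exp_add]; simp
    have h3 : bc * (1 + w) ≤ bc * Real.exp w := by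
      gcongr
      linarith [Real.add_one_le_exp w]
    linarith
  have h4 : bc * x ≤ bc * (A * w + B) := by gcongr
  have h5 : A * (bc * (1 + w)) ≤ A * 1 := by gcongr
  nlinarith [mul_nonneg hB (sub_nonneg.2 hbc1), mul_le_mul_of_nonneg_right hx (sub_nonneg.2 hbc1)]

/-- Clipping at `0` only increases the sum. Clipping at `2` is harmless: if `u > 2` then `v < 0`,
and the clipped sum is already `2`. A single gap between states need not be bounded, only the sum of
the two. -/
lemma clip_add_clip_ge {u v : ℝ} (h : u + v ≤ 2) :
    u + v ≤ max 0 (min 2 u) + max 0 (min 2 v) := by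
  rcases le_total u 2 with h1 | h1 <;> rcases le_total v 2 with h2 | h2 <;>
  rcases le_total u 0 with h3 | h3 <;> rcases le_total v 0 with h4 | h4 <;>
  simp [*] <;> linarith

/-- When `q` is not exponentially smaller than `p`, the factor `p` may be traded for `p ^ (1 - α) *
q ^ α` at the cost `exp θ`. This converts the weight of a pair in the regret into its weight in the
potential decrease. -/
lemma mul_le_rpow_mul {α θ p q : ℝ} (hα : 0 < α) (hα1 : α < 1) (hp : 0 ≤ p) (hq : 0 ≤ q)
    (h : Real.exp (-(θ / α)) * p ≤ q) :
    p * q ≤ Real.exp θ * (p ^ (1 - α) * q ^ α * q) := by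
  rcases hp.eq_or_lt with rfl | hp
  · simp [Real.zero_rpow (by linarith : (1 - α) ≠ 0)]
  have h1 : (Real.exp (-(θ / α)) * p) ^ α ≤ q ^ α := by gcongr
  rw [Real.mul_rpow (Real.exp_pos _).le hp.le, ← Real.exp_mul] at h1
  have h2 : -(θ / α) * α = -θ := by field_simp
  rw [h2] at h1
  have h3 : p = p ^ (1 - α) * p ^ α := by
    rw [← Real.rpow_add hp]; simp
  have h4 : p ^ α ≤ Real.exp θ * q ^ α := by
    calc p ^ α = Real.exp θ * (Real.exp (-θ) * p ^ α) := by
          rw [← mul_assoc, ← Real.exp_add]; simp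
      _ ≤ _ := by gcongr
  calc p * q = p ^ (1 - α) * p ^ α * q := by rw [← h3]
    _ ≤ p ^ (1 - α) * (Real.exp θ * q ^ α) * q := by gcongr
    _ = _ := by ring

/-- The one-round inequality between the regret of posterior sampling and the decrease of the
potential `∑ s b, p s ^ (1 - α) * p b ^ α`. -/
lemma posterior_sampling_step {S ι : Type*} [Fintype S] [DecidableEq S] (p : S → ℝ)
    (hp : ∀ s, 0 ≤ p s) (hp1 : ∑ s, p s = 1) (m : ι → S → ℝ) (sel : S → ι)
    (hgap : ∀ s i j, m i s - m j s ≤ 1)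
    (bc : ι → S → S → ℝ) (hbc0 : ∀ i s b, 0 ≤ bc i s b) (hbc1 : ∀ i s b, bc i s b ≤ 1)
    {α θ A V : ℝ} (hα : 0 < α) (hα1 : α < 1) (hA : 0 < A) (hV : 0 ≤ V)
    (hbc : ∀ i s b, bc i s b ≤ Real.exp (-((m i b - m i s) / A - V / A ^ 2))) :
    ∑ s, ∑ b, p s * p b * (m (sel s) s - m (sel b) s) +
      Real.exp θ * (2 + A) * ∑ s, ∑ b, p s ^ (1 - α) * p b ^ α * ∑ c, p c * bc (sel c) s b ≤
    Real.exp θ * (2 + A) * ∑ s, ∑ b, p s ^ (1 - α) * p b ^ α +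
      (V / A + 2 * Real.exp (-(θ / α)) * (Fintype.card S - 1)) := by
  set φ : S → S → ℝ := fun s b => max 0 (min 2 (m (sel b) b - m (sel b) s)) with hφ
  have hexch : ∑ s, ∑ b, p s * p b * (m (sel s) s - m (sel b) s) ≤
      ∑ s, ∑ b, p s * p b * φ s b := by
    have hsw : ∀ f : S → S → ℝ, 2 * ∑ s, ∑ b, p s * p b * f s b =
        ∑ s, ∑ b, p s * p b * (f s b + f b s) := by
      intro f
      have : ∑ s, ∑ b, p s * p b * f s b = ∑ s, ∑ b, p s * p b * f b s := by
        rw [Finset.sum_comm]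
        exact Finset.sum_congr rfl fun s _ => Finset.sum_congr rfl fun b _ => by ring
      simp only [mul_add, Finset.sum_add_distrib]
      rw [← this]; ring
    have : 2 * ∑ s, ∑ b, p s * p b * (m (sel s) s - m (sel b) s) ≤
        2 * ∑ s, ∑ b, p s * p b * φ s b := by
      rw [hsw, hsw]
      refine Finset.sum_le_sum fun s _ => Finset.sum_le_sum fun b _ => ?_
      refine mul_le_mul_of_nonneg_left ?_ (mul_nonneg (hp s) (hp b))
      -- Regrouped, `u + v` is the regret of `sel b` in state `s` plus that of `sel s` in state `b`,
      -- hence at most `2`.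
      have h1 := clip_add_clip_ge (u := m (sel b) b - m (sel b) s)
        (v := m (sel s) s - m (sel s) b)
        (by linarith [hgap s (sel s) (sel b), hgap b (sel b) (sel s)])
      simp only [hφ]
      linarith
    linarith
  have hterm : ∀ s b, p s * p b * φ s b ≤ p s * p b * (V / A) +
      Real.exp θ * (2 + A) * (p s ^ (1 - α) * p b ^ α * (p b * (1 - bc (sel b) s b))) +
      (if s = b then 0 else 2 * Real.exp (-(θ / α)) * p s) := by
    intro s b
    have hφ0 : 0 ≤ φ s b := le_max_left _ _
    have hφ2 : φ s b ≤ 2 := max_le (by norm_num) (min_le_left _ _)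
    have hps := hp s
    have hpb := hp b
    have hVA : 0 ≤ V / A := by positivity
    have h1bc : 0 ≤ 1 - bc (sel b) s b := sub_nonneg.2 (hbc1 _ _ _)
    have hr : 0 ≤ Real.exp θ * (2 + A) *
        (p s ^ (1 - α) * p b ^ α * (p b * (1 - bc (sel b) s b))) := by positivity
    have hl : 0 ≤ p s * p b * (V / A) := by positivity
    split_ifs with hsb
    · subst hsb
      have : φ s s = 0 := by simp [hφ]
      rw [this]; linarith
    -- Either `b` is likely enough for the trade of `mul_le_rpow_mul`, or `p b` is at most `exp (-(θ
    -- / α)) * p s` and the crude bound `φ ≤ 2` suffices.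
    · rcases le_total (Real.exp (-(θ / α)) * p s) (p b) with h | h
      · have h1 : φ s b ≤ (2 + A) * (1 - bc (sel b) s b) + V / A := by
          rcases le_total (m (sel b) b - m (sel b) s) 0 with hd | hd
          · have : φ s b = 0 := max_eq_left ((min_le_right _ _).trans hd)
            rw [this]
            positivity
          · refine min_gap_le ((m (sel b) b - m (sel b) s) / A - V / A ^ 2) hA hVA hφ2
              (hbc0 _ _ _) (hbc1 _ _ _) (hbc _ _ _) ?_
            have : A * ((m (sel b) b - m (sel b) s) / A - V / A ^ 2) + V / A =
                m (sel b) b - m (sel b) s := by field_simp; ring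
            rw [this]
            exact max_le hd (min_le_right _ _)
        have h2 := mul_le_rpow_mul hα hα1 hps hpb h
        have h3 : 0 ≤ 2 * Real.exp (-(θ / α)) * p s := by positivity
        calc p s * p b * φ s b
            ≤ p s * p b * ((2 + A) * (1 - bc (sel b) s b) + V / A) := by gcongr
          _ = p s * p b * (V / A) + p s * p b * ((2 + A) * (1 - bc (sel b) s b)) := by ring
          _ ≤ p s * p b * (V / A) + Real.exp θ * (p s ^ (1 - α) * p b ^ α * p b) *
              ((2 + A) * (1 - bc (sel b) s b)) := by gcongr
          _ = p s * p b * (V / A) + Real.exp θ * (2 + A) *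
              (p s ^ (1 - α) * p b ^ α * (p b * (1 - bc (sel b) s b))) := by ring
          _ ≤ _ := by linarith
      · have hp1' : p s ≤ 1 := hp1 ▸ Finset.single_le_sum (fun i _ => hp i) (Finset.mem_univ s)
        calc p s * p b * φ s b ≤ 1 * (Real.exp (-(θ / α)) * p s) * 2 := by gcongr
          _ = 2 * Real.exp (-(θ / α)) * p s := by ring
          _ ≤ _ := by linarith
  have hsum : ∑ s, ∑ b, p s * p b * φ s b ≤ V / A + Real.exp θ * (2 + A) *
      (∑ s, ∑ b, p s ^ (1 - α) * p b ^ α * (p b * (1 - bc (sel b) s b))) +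
      2 * Real.exp (-(θ / α)) * (Fintype.card S - 1) := by
    refine (Finset.sum_le_sum fun s _ => Finset.sum_le_sum fun b _ => hterm s b).trans ?_
    simp only [Finset.sum_add_distrib]
    have e1 : ∑ s, ∑ b, p s * p b * (V / A) = V / A := by
      simp only [← Finset.sum_mul, ← Finset.mul_sum, hp1, one_mul, mul_one]
    have e2 : ∑ s, ∑ b, (if s = b then 0 else 2 * Real.exp (-(θ / α)) * p s) =
        2 * Real.exp (-(θ / α)) * (Fintype.card S - 1) := by
      have : ∀ s, ∑ b, (if s = b then 0 else 2 * Real.exp (-(θ / α)) * p s) =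
          (2 * Real.exp (-(θ / α)) * (Fintype.card S - 1)) * p s := by
        intro s
        have : ∀ b, (if s = b then (0 : ℝ) else 2 * Real.exp (-(θ / α)) * p s) =
            2 * Real.exp (-(θ / α)) * p s - if s = b then 2 * Real.exp (-(θ / α)) * p s else 0 := by
          intro b; split_ifs <;> simp
        simp only [this, Finset.sum_sub_distrib, Finset.sum_ite_eq, Finset.mem_univ, if_true,
          Finset.sum_const, Finset.card_univ, nsmul_eq_mul]
        ring
      simp only [this, ← Finset.mul_sum, hp1, mul_one]
    rw [e1, e2]
    simp only [Finset.mul_sum]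
    rfl
  -- Of the mean loss over the sampled state `c`, only the term `c = b` is kept: the action `sel b`
  -- is the one that separates `s` from `b`.
  have hdec : ∑ s, ∑ b, p s ^ (1 - α) * p b ^ α * (p b * (1 - bc (sel b) s b)) +
      ∑ s, ∑ b, p s ^ (1 - α) * p b ^ α * ∑ c, p c * bc (sel c) s b ≤
      ∑ s, ∑ b, p s ^ (1 - α) * p b ^ α := by
    rw [← Finset.sum_add_distrib]
    refine Finset.sum_le_sum fun s _ => ?_
    rw [← Finset.sum_add_distrib]
    refine Finset.sum_le_sum fun b _ => ?_
    rw [← mul_add]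
    refine mul_le_of_le_one_right
      (mul_nonneg (Real.rpow_nonneg (hp s) _) (Real.rpow_nonneg (hp b) _)) ?_
    have h1 : p b * (1 - bc (sel b) s b) ≤ ∑ c, p c * (1 - bc (sel c) s b) :=
      Finset.single_le_sum (f := fun c => p c * (1 - bc (sel c) s b))
        (fun i _ => mul_nonneg (hp i) (sub_nonneg.2 (hbc1 _ _ _))) (Finset.mem_univ b)
    simp only [mul_sub, mul_one, Finset.sum_sub_distrib, hp1] at h1 ⊢
    linarith
  have := mul_le_mul_of_nonneg_left hdec (by positivity : 0 ≤ Real.exp θ * (2 + A))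
  linarith

/-- The optimum is `A = √(b / a)`. For `b = 0` (which includes zero noise) the infimum is not
attained and `A` tends to `0`. -/
lemma le_add_two_sqrt_of_forall_pos {r C a b : ℝ} (ha : 0 < a) (hb : 0 ≤ b)
    (h : ∀ A > 0, r ≤ C + a * A + b / A) : r ≤ C + 2 * √(a * b) := by
  rcases hb.eq_or_lt with rfl | hb
  · simp only [zero_div, add_zero, mul_zero, Real.sqrt_zero] at h ⊢
    refine le_of_forall_pos_le_add fun ε hε => ?_
    have := h (ε / a) (by positivity)
    rwa [mul_div_cancel₀ _ ha.ne'] at this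
  · have h1 := h (√(a * b) / a) (by positivity)
    have h2 : a * (√(a * b) / a) = √(a * b) := by field_simp
    have h3 : b / (√(a * b) / a) = √(a * b) := by
      have : 0 < √(a * b) := by positivity
      rw [div_eq_iff (by positivity), ← mul_div_assoc, Real.mul_self_sqrt (by positivity)]
      field_simp
    rw [h2, h3] at h1
    linarith

/-! ### Affinity of sub-Gaussian distributions -/

lemma lintegral_exp_le_of_hasSubgaussianMGF {Ω : Type*} [MeasurableSpace Ω] {μ : Measure Ω}
    {X : Ω → ℝ} {c : ℝ≥0} (h : HasSubgaussianMGF X c μ) (t : ℝ) :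
    ∫⁻ ω, ENNReal.ofReal (Real.exp (t * X ω)) ∂μ ≤ ENNReal.ofReal (Real.exp (c * t ^ 2 / 2)) := by
  rw [← ofReal_integral_eq_lintegral_ofReal (h.integrable_exp_mul t)
    (Filter.Eventually.of_forall fun _ => (Real.exp_pos _).le)]
  exact ENNReal.ofReal_le_ofReal (h.mgf_le t)

/-- The Rényi affinity of two sub-Gaussian distributions, in terms of the gap of the means. -/
lemma lintegral_rpow_mul_rpow_le {M : Measure ℝ} {f g : ℝ → ℝ≥0∞} (hf : Measurable f)
    (hg : Measurable g) {u v : ℝ} {c : ℝ≥0}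
    (hfs : HasSubgaussianMGF (fun r => r - u) c (M.withDensity f))
    (hgs : HasSubgaussianMGF (fun r => r - v) c (M.withDensity g))
    {α : ℝ} (hα : 0 < α) (hα1 : α < 1) (l : ℝ) :
    ∫⁻ r, f r ^ (1 - α) * g r ^ α ∂M ≤
      ENNReal.ofReal (Real.exp (-(l * (v - u) - c / (2 * α * (1 - α)) * l ^ 2))) := by
  have hα1' : 0 < 1 - α := by linarith
  -- Exponential tilts chosen so that in `F ^ (1 - α) * G ^ α` the variable `r` cancels from the
  -- exponent, leaving the constant `exp (l * (v - u))`. After Hölder, the two moment bounds add up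
  -- to `c * l ^ 2 / (2 * α * (1 - α))`.
  set F : ℝ → ℝ≥0∞ := fun r => f r * ENNReal.ofReal (Real.exp (l / (1 - α) * (r - u))) with hF
  set G : ℝ → ℝ≥0∞ := fun r => g r * ENNReal.ofReal (Real.exp (-(l / α) * (r - v))) with hG
  have hFm : Measurable F := by fun_prop
  have hGm : Measurable G := by fun_prop
  have key : ∀ r, f r ^ (1 - α) * g r ^ α =
      ENNReal.ofReal (Real.exp (-(l * (v - u)))) * (F r ^ (1 - α) * G r ^ α) := by
    intro r
    simp only [hF, hG]
    rw [ENNReal.mul_rpow_of_nonneg _ _ hα1'.le, ENNReal.mul_rpow_of_nonneg _ _ hα.le,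
      ENNReal.ofReal_rpow_of_pos (Real.exp_pos _), ENNReal.ofReal_rpow_of_pos (Real.exp_pos _),
      ← Real.exp_mul, ← Real.exp_mul]
    have e : ENNReal.ofReal (Real.exp (-(l * (v - u)))) *
        (ENNReal.ofReal (Real.exp (l / (1 - α) * (r - u) * (1 - α))) *
        ENNReal.ofReal (Real.exp (-(l / α) * (r - v) * α))) = 1 := by
      rw [← ENNReal.ofReal_mul (Real.exp_pos _).le, ← ENNReal.ofReal_mul (Real.exp_pos _).le,
        ← Real.exp_add, ← Real.exp_add]
      have : -(l * (v - u)) + (l / (1 - α) * (r - u) * (1 - α) + -(l / α) * (r - v) * α) = 0 := by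
        field_simp; ring
      rw [this]; simp
    calc f r ^ (1 - α) * g r ^ α = f r ^ (1 - α) * g r ^ α * 1 := (mul_one _).symm
      _ = _ := by rw [← e]; ring
  have hFi : ∫⁻ r, F r ∂M ≤ ENNReal.ofReal (Real.exp (c * (l / (1 - α)) ^ 2 / 2)) := by
    have := lintegral_exp_le_of_hasSubgaussianMGF hfs (l / (1 - α))
    rwa [lintegral_withDensity_eq_lintegral_mul _ hf (by fun_prop)] at this
  have hGi : ∫⁻ r, G r ∂M ≤ ENNReal.ofReal (Real.exp (c * (-(l / α)) ^ 2 / 2)) := by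
    have := lintegral_exp_le_of_hasSubgaussianMGF hgs (-(l / α))
    rwa [lintegral_withDensity_eq_lintegral_mul _ hg (by fun_prop)] at this
  simp only [key]
  rw [lintegral_const_mul _ (by fun_prop)]
  calc ENNReal.ofReal (Real.exp (-(l * (v - u)))) * ∫⁻ r, F r ^ (1 - α) * G r ^ α ∂M
      ≤ ENNReal.ofReal (Real.exp (-(l * (v - u)))) *
        ((∫⁻ r, F r ∂M) ^ (1 - α) * (∫⁻ r, G r ∂M) ^ α) := by
        gcongr
        exact ENNReal.lintegral_mul_norm_pow_le hFm.aemeasurable hGm.aemeasurable hα1'.le hα.le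
          (by ring)
    _ ≤ ENNReal.ofReal (Real.exp (-(l * (v - u)))) *
        (ENNReal.ofReal (Real.exp (c * (l / (1 - α)) ^ 2 / 2)) ^ (1 - α) *
          ENNReal.ofReal (Real.exp (c * (-(l / α)) ^ 2 / 2)) ^ α) := by gcongr
    _ = _ := by
        rw [ENNReal.ofReal_rpow_of_pos (Real.exp_pos _), ENNReal.ofReal_rpow_of_pos (Real.exp_pos _),
          ← Real.exp_mul, ← Real.exp_mul, ← ENNReal.ofReal_mul (Real.exp_pos _).le,
          ← ENNReal.ofReal_mul (Real.exp_pos _).le, ← Real.exp_add, ← Real.exp_add]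
        congr 2
        field_simp
        ring

/-! ### Measurability of the records -/

section

variable {𝒳 𝒮 : Type*} {K : ℕ}

lemma obs_snoc {t : ℕ} (ω : Fin t → Round 𝒳 𝒮 K) (q : Round 𝒳 𝒮 K) :
    obs (Fin.snoc (α := fun _ => Round 𝒳 𝒮 K) ω q : Fin (t + 1) → Round 𝒳 𝒮 K) =
      Fin.snoc (α := fun _ => 𝒳 × Fin K × ℝ) (obs ω) (q.1, q.2.2.1, q.2.2.2) := by
  funext i
  refine Fin.lastCases ?_ (fun j => ?_) i <;> simp [obs]

variable [MeasurableSpace 𝒳] [MeasurableSpace 𝒮]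

lemma measurable_snoc {t : ℕ} : Measurable (fun q : (Fin t → Round 𝒳 𝒮 K) × Round 𝒳 𝒮 K =>
    (Fin.snoc (α := fun _ => Round 𝒳 𝒮 K) q.1 q.2 : Fin (t + 1) → Round 𝒳 𝒮 K)) := by
  rw [measurable_pi_iff]
  intro i
  refine Fin.lastCases ?_ (fun j => ?_) i
  · simpa using measurable_snd
  · simp only [Fin.snoc_castSucc]; fun_prop

lemma measurable_snoc_right {t : ℕ} (ω : Fin t → Round 𝒳 𝒮 K) :
    Measurable (fun q : Round 𝒳 𝒮 K =>
      (Fin.snoc (α := fun _ => Round 𝒳 𝒮 K) ω q : Fin (t + 1) → Round 𝒳 𝒮 K)) :=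
  measurable_snoc.comp (by fun_prop : Measurable fun q : Round 𝒳 𝒮 K => (ω, q))

lemma measurable_round {select : 𝒳 → 𝒮 → Fin K} (hselect : Measurable (Function.uncurry select)) :
    Measurable (fun q : (𝒳 × 𝒮) × ℝ =>
      ((q.1.1, q.1.2, select q.1.1 q.1.2, q.2) : Round 𝒳 𝒮 K)) := by
  have h : Measurable (fun q : (𝒳 × 𝒮) × ℝ => select q.1.1 q.1.2) :=
    hselect.comp measurable_fst
  fun_prop

end

/-! ### Change of measure to the reference law -/

section

variable {𝒳 𝒮 Θ : Type*} {K : ℕ} [MeasurableSpace 𝒳] [MeasurableSpace 𝒮] [Fintype 𝒮]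

/-- The sum of the reward distributions over all latent states. -/
noncomputable def dominatingKernel (P : Θ → Kernel (Fin K × 𝒳 × 𝒮) ℝ) (θ : Θ) :
    Kernel (Fin K × 𝒳) ℝ :=
  ∑ s', stateKernel P θ s'

instance (P : Θ → Kernel (Fin K × 𝒳 × 𝒮) ℝ) [∀ θ, IsMarkovKernel (P θ)] (θ : Θ) (s : 𝒮) :
    IsMarkovKernel (stateKernel P θ s) := by
  unfold stateKernel; infer_instance

instance (P : Θ → Kernel (Fin K × 𝒳 × 𝒮) ℝ) [∀ θ, IsMarkovKernel (P θ)] (θ : Θ) :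
    IsFiniteKernel (dominatingKernel P θ) := by
  refine ⟨Fintype.card 𝒮, ENNReal.natCast_lt_top _, fun q => ?_⟩
  rw [dominatingKernel, Kernel.finsetSum_apply']
  simp

lemma measurable_likelihood (P : Θ → Kernel (Fin K × 𝒳 × 𝒮) ℝ) (θ : Θ) (s : 𝒮) :
    Measurable (likelihood (𝒳 := 𝒳) P θ s) := by
  unfold likelihood
  have hf : Measurable (fun q : 𝒳 × Fin K × ℝ => ((q.2.1, q.1), q.2.2)) := by fun_prop
  exact (Kernel.measurable_rnDeriv (stateKernel P θ s) (∑ s', stateKernel P θ s')).comp hf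

lemma withDensity_likelihood (P : Θ → Kernel (Fin K × 𝒳 × 𝒮) ℝ) [∀ θ, IsMarkovKernel (P θ)]
    (θ : Θ) (s : 𝒮) (a : Fin K) (x : 𝒳) :
    (dominatingKernel P θ (a, x)).withDensity (fun r => likelihood P θ s (x, a, r)) =
      P θ (a, x, s) := by
  have hac : stateKernel P θ s (a, x) ≪ dominatingKernel P θ (a, x) := by
    refine Measure.absolutelyContinuous_of_le fun A => ?_
    rw [dominatingKernel, Kernel.finsetSum_apply']
    exact Finset.single_le_sum (f := fun i => stateKernel P θ i (a, x) A) (fun _ _ => zero_le)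
      (Finset.mem_univ s)
  have h := Kernel.withDensity_rnDeriv_eq hac
  rw [Kernel.withDensity_apply _ (Kernel.measurable_rnDeriv _ _)] at h
  exact h

/-- The Rényi affinity `∫ P(r ∣ a, x, s)^(1-α) P(r ∣ a, x, b)^α` of two latent states. -/
noncomputable def affinity (P : Θ → Kernel (Fin K × 𝒳 × 𝒮) ℝ) (θ : Θ) (α : ℝ) (x : 𝒳)
    (a : Fin K) (s b : 𝒮) : ℝ≥0∞ :=
  ∫⁻ r, likelihood P θ s (x, a, r) ^ (1 - α) * likelihood P θ b (x, a, r) ^ α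
    ∂(dominatingKernel P θ (a, x))

lemma affinity_le (P : Θ → Kernel (Fin K × 𝒳 × 𝒮) ℝ) [∀ θ, IsMarkovKernel (P θ)] (θ : Θ) {c : ℝ≥0}
    (hσ : ∀ a x s, HasSubgaussianMGF (fun r => r - meanReward P a x s θ) c (P θ (a, x, s)))
    {α : ℝ} (hα : 0 < α) (hα1 : α < 1) (x : 𝒳) (a : Fin K) (s b : 𝒮) (l : ℝ) :
    affinity P θ α x a s b ≤ ENNReal.ofReal (Real.exp (-(l * (meanReward P a x b θ -
      meanReward P a x s θ) - c / (2 * α * (1 - α)) * l ^ 2))) := by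
  have hm : ∀ s, Measurable fun r => likelihood P θ s (x, a, r) := fun s =>
    (measurable_likelihood P θ s).comp (by fun_prop)
  refine lintegral_rpow_mul_rpow_le (hm s) (hm b) ?_ ?_ hα hα1 l
  · rw [withDensity_likelihood]; exact hσ a x s
  · rw [withDensity_likelihood]; exact hσ a x b

lemma affinity_le_one (P : Θ → Kernel (Fin K × 𝒳 × 𝒮) ℝ) [∀ θ, IsMarkovKernel (P θ)] (θ : Θ)
    {c : ℝ≥0}
    (hσ : ∀ a x s, HasSubgaussianMGF (fun r => r - meanReward P a x s θ) c (P θ (a, x, s)))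
    {α : ℝ} (hα : 0 < α) (hα1 : α < 1) (x : 𝒳) (a : Fin K) (s b : 𝒮) :
    affinity P θ α x a s b ≤ 1 := by
  simpa using affinity_le P θ hσ hα hα1 x a s b 0

/-- The dominating kernel of the reward of a round. -/
noncomputable def dominatingStep (P : Θ → Kernel (Fin K × 𝒳 × 𝒮) ℝ) (θ : Θ)
    (select : 𝒳 → 𝒮 → Fin K) (hselect : Measurable (Function.uncurry select)) (t : ℕ) :
    Kernel ((Fin t → Round 𝒳 𝒮 K) × 𝒳 × 𝒮) ℝ :=
  (dominatingKernel P θ).comap (fun p => (select p.2.1 p.2.2, p.2.1))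
    ((hselect.comp measurable_snd).prodMk (measurable_fst.comp measurable_snd))

instance (P : Θ → Kernel (Fin K × 𝒳 × 𝒮) ℝ) [∀ θ, IsMarkovKernel (P θ)] (θ : Θ)
    (select : 𝒳 → 𝒮 → Fin K) (hselect : Measurable (Function.uncurry select)) (t : ℕ) :
    IsFiniteKernel (dominatingStep P θ select hselect t) := by
  unfold dominatingStep; exact Kernel.IsFiniteKernel.comap _ _

/-- The law of one round with the reward drawn from the dominating kernel. -/
noncomputable def referenceStep (P : Θ → Kernel (Fin K × 𝒳 × 𝒮) ℝ) (θ : Θ)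
    (P₁ : Measure 𝒮) (ctx : (t : ℕ) → Kernel (Hist 𝒳 K t) 𝒳)
    (select : 𝒳 → 𝒮 → Fin K) (hselect : Measurable (Function.uncurry select)) (t : ℕ) :
    Kernel (Fin t → Round 𝒳 𝒮 K) (Round 𝒳 𝒮 K) :=
  ((((ctx t).comap obs measurable_obs) ⊗ₖ
      ((posteriorKernel P θ P₁ t).comap (fun p => obs p.1) (measurable_obs.comp measurable_fst))) ⊗ₖ
    dominatingStep P θ select hselect t).map
    (fun q => (q.1.1, q.1.2, select q.1.1 q.1.2, q.2))

/-- The measure on the records of `t` rounds with respect to which the joint law of the latent state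
and the records has the density `weight`. -/
noncomputable def referenceLaw (P : Θ → Kernel (Fin K × 𝒳 × 𝒮) ℝ) (θ : Θ)
    (P₁ : Measure 𝒮) (ctx : (t : ℕ) → Kernel (Hist 𝒳 K t) 𝒳)
    (select : 𝒳 → 𝒮 → Fin K) (hselect : Measurable (Function.uncurry select)) :
    (t : ℕ) → Measure (Fin t → Round 𝒳 𝒮 K)
  | 0 => Measure.dirac Fin.elim0
  | t + 1 =>
    ((referenceLaw P θ P₁ ctx select hselect t) ⊗ₘ
      (referenceStep P θ P₁ ctx select hselect t)).map
      (fun q => Fin.snoc (α := fun _ => Round 𝒳 𝒮 K) q.1 q.2)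

lemma weight_obs_snoc (P : Θ → Kernel (Fin K × 𝒳 × 𝒮) ℝ) (θ : Θ) (P₁ : Measure 𝒮) {t : ℕ}
    (ω : Fin t → Round 𝒳 𝒮 K) (q : Round 𝒳 𝒮 K) (s : 𝒮) :
    weight P θ P₁ (obs (Fin.snoc (α := fun _ => Round 𝒳 𝒮 K) ω q : Fin (t + 1) → Round 𝒳 𝒮 K)) s =
      weight P θ P₁ (obs ω) s * likelihood P θ s (q.1, q.2.2.1, q.2.2.2) := by
  rw [obs_snoc]
  simp [weight, Fin.prod_univ_castSucc, mul_assoc]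

section

variable (P : Θ → Kernel (Fin K × 𝒳 × 𝒮) ℝ) [∀ θ, IsMarkovKernel (P θ)] (θ : Θ)
    (P₁ : Measure 𝒮) [IsProbabilityMeasure P₁] (ctx : (t : ℕ) → Kernel (Hist 𝒳 K t) 𝒳)
    [∀ t, IsMarkovKernel (ctx t)]
    (select : 𝒳 → 𝒮 → Fin K) (hselect : Measurable (Function.uncurry select))

instance (t : ℕ) : IsMarkovKernel (contextStep (𝒮 := 𝒮) (ctx t)) := by
  unfold contextStep; infer_instance

instance (t : ℕ) : IsMarkovKernel (sampleStep P θ P₁ t) := by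
  unfold sampleStep; infer_instance

instance (t : ℕ) : IsMarkovKernel (rewardStep P θ select hselect t) := by
  unfold rewardStep; exact Kernel.IsMarkovKernel.comap _ _

instance (t : ℕ) : IsMarkovKernel (stepKernel P θ θ P₁ ctx select hselect t) := by
  unfold stepKernel
  exact Kernel.IsMarkovKernel.map _ (measurable_round hselect)

instance (t : ℕ) : IsFiniteKernel (referenceStep P θ P₁ ctx select hselect t) := by
  unfold referenceStep
  exact Kernel.IsFiniteKernel.map _ _

instance (t : ℕ) : IsFiniteMeasure (referenceLaw P θ P₁ ctx select hselect t) := by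
  induction t with
  | zero => unfold referenceLaw; infer_instance
  | succ t ih => unfold referenceLaw; infer_instance

instance (t : ℕ) : IsProbabilityMeasure (law P θ θ P₁ ctx select hselect t) := by
  induction t with
  | zero =>
    unfold law
    exact Measure.isProbabilityMeasure_map (by fun_prop)
  | succ t ih =>
    unfold law
    refine Measure.isProbabilityMeasure_map (Measurable.aemeasurable ?_)
    exact (measurable_fst.comp measurable_fst).prodMk
      (measurable_snoc.comp ((measurable_snd.comp measurable_fst).prodMk measurable_snd))

lemma lintegral_law_succ (t : ℕ) {F : 𝒮 × (Fin (t + 1) → Round 𝒳 𝒮 K) → ℝ≥0∞}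
    (hF : Measurable F) :
    ∫⁻ p, F p ∂(law P θ θ P₁ ctx select hselect (t + 1)) =
      ∫⁻ p, ∫⁻ q, F (p.1, Fin.snoc (α := fun _ => Round 𝒳 𝒮 K) p.2 q)
        ∂(stepKernel P θ θ P₁ ctx select hselect t p) ∂(law P θ θ P₁ ctx select hselect t) := by
  have hm : Measurable (fun q : (𝒮 × (Fin t → Round 𝒳 𝒮 K)) × Round 𝒳 𝒮 K =>
      (q.1.1, (Fin.snoc (α := fun _ => Round 𝒳 𝒮 K) q.1.2 q.2 :
        Fin (t + 1) → Round 𝒳 𝒮 K))) :=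
    (measurable_fst.comp measurable_fst).prodMk
      (measurable_snoc.comp ((measurable_snd.comp measurable_fst).prodMk measurable_snd))
  have hG : Measurable (fun q : (𝒮 × (Fin t → Round 𝒳 𝒮 K)) × Round 𝒳 𝒮 K =>
      F (q.1.1, Fin.snoc (α := fun _ => Round 𝒳 𝒮 K) q.1.2 q.2)) := hF.comp hm
  rw [law, lintegral_map hF hm, Measure.lintegral_compProd hG]

lemma lintegral_referenceLaw_succ (t : ℕ) {F : (Fin (t + 1) → Round 𝒳 𝒮 K) → ℝ≥0∞}
    (hF : Measurable F) :
    ∫⁻ ω, F ω ∂(referenceLaw P θ P₁ ctx select hselect (t + 1)) =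
      ∫⁻ ω, ∫⁻ q, F (Fin.snoc (α := fun _ => Round 𝒳 𝒮 K) ω q)
        ∂(referenceStep P θ P₁ ctx select hselect t ω)
        ∂(referenceLaw P θ P₁ ctx select hselect t) := by
  have hG : Measurable (fun q : (Fin t → Round 𝒳 𝒮 K) × Round 𝒳 𝒮 K =>
      F (Fin.snoc (α := fun _ => Round 𝒳 𝒮 K) q.1 q.2)) := hF.comp measurable_snoc
  rw [referenceLaw, lintegral_map hF measurable_snoc, Measure.lintegral_compProd hG]

variable [MeasurableSingletonClass 𝒮]

lemma lintegral_stepKernel (t : ℕ) (s : 𝒮) (ω : Fin t → Round 𝒳 𝒮 K) {F : Round 𝒳 𝒮 K → ℝ≥0∞}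
    (hF : Measurable F) :
    ∫⁻ q, F q ∂(stepKernel P θ θ P₁ ctx select hselect t (s, ω)) =
      ∫⁻ x, ∑ b, (∫⁻ r, F (x, b, select x b, r) ∂(P θ (select x b, x, s))) *
        posteriorMeasure P θ P₁ (obs ω) {b} ∂(ctx t (obs ω)) := by
  have hG : Measurable fun q : (𝒳 × 𝒮) × ℝ => F (q.1.1, q.1.2, select q.1.1 q.1.2, q.2) :=
    hF.comp (measurable_round hselect)
  rw [stepKernel, Kernel.lintegral_map _ (measurable_round hselect) _ hF,
    Kernel.lintegral_compProd _ _ _ hG,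
    Kernel.lintegral_compProd _ _ _ ?_]
  · refine lintegral_congr fun x => ?_
    rw [lintegral_fintype]
    rfl
  · exact Measurable.lintegral_kernel_prod_right' (κ := (rewardStep P θ select hselect t).comap
      (fun q => ((s, ω), q)) (by fun_prop)) hG

lemma lintegral_referenceStep (t : ℕ) (ω : Fin t → Round 𝒳 𝒮 K) {F : Round 𝒳 𝒮 K → ℝ≥0∞}
    (hF : Measurable F) :
    ∫⁻ q, F q ∂(referenceStep P θ P₁ ctx select hselect t ω) =
      ∫⁻ x, ∑ b, (∫⁻ r, F (x, b, select x b, r) ∂(dominatingKernel P θ (select x b, x))) *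
        posteriorMeasure P θ P₁ (obs ω) {b} ∂(ctx t (obs ω)) := by
  have hG : Measurable fun q : (𝒳 × 𝒮) × ℝ => F (q.1.1, q.1.2, select q.1.1 q.1.2, q.2) :=
    hF.comp (measurable_round hselect)
  rw [referenceStep, Kernel.lintegral_map _ (measurable_round hselect) _ hF,
    Kernel.lintegral_compProd _ _ _ hG,
    Kernel.lintegral_compProd _ _ _ ?_]
  · refine lintegral_congr fun x => ?_
    rw [lintegral_fintype]
    rfl
  · exact Measurable.lintegral_kernel_prod_right' (κ := (dominatingStep P θ select hselect t).comap
      (fun q => (ω, q)) (by fun_prop)) hG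

/-- Neither the context nor the sampled state depends on the latent state beyond the history, so
only the reward law differs between the two kernels, and its density is the likelihood. -/
lemma lintegral_stepKernel_eq_referenceStep (t : ℕ) (s : 𝒮) (ω : Fin t → Round 𝒳 𝒮 K)
    {F : Round 𝒳 𝒮 K → ℝ≥0∞} (hF : Measurable F) :
    ∫⁻ q, F q ∂(stepKernel P θ θ P₁ ctx select hselect t (s, ω)) =
      ∫⁻ q, likelihood P θ s (q.1, q.2.2.1, q.2.2.2) * F q
        ∂(referenceStep P θ P₁ ctx select hselect t ω) := by
  have hl := measurable_likelihood (𝒳 := 𝒳) P θ s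
  have hlF : Measurable fun q : Round 𝒳 𝒮 K => likelihood P θ s (q.1, q.2.2.1, q.2.2.2) * F q :=
    (hl.comp (by fun_prop)).mul hF
  rw [lintegral_stepKernel P θ P₁ ctx select hselect t s ω hF,
    lintegral_referenceStep P θ P₁ ctx select hselect t ω hlF]
  refine lintegral_congr fun x => Finset.sum_congr rfl fun b _ => ?_
  have hl' : Measurable fun r => likelihood P θ s (x, select x b, r) := hl.comp (by fun_prop)
  have hF' : Measurable fun r => F (x, b, select x b, r) := hF.comp (by fun_prop)
  rw [← withDensity_likelihood P θ s (select x b) x,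
    lintegral_withDensity_eq_lintegral_mul _ hl' hF']
  rfl

/-- The joint law of the latent state and the records has the density `weight` with respect to
the reference law. -/
lemma lintegral_law (t : ℕ) {F : 𝒮 × (Fin t → Round 𝒳 𝒮 K) → ℝ≥0∞} (hF : Measurable F) :
    ∫⁻ p, F p ∂(law P θ θ P₁ ctx select hselect t) =
      ∫⁻ ω, ∑ s, weight P θ P₁ (obs ω) s * F (s, ω)
        ∂(referenceLaw P θ P₁ ctx select hselect t) := by
  induction t with
  | zero =>
    have hm : Measurable fun ω : Fin 0 → Round 𝒳 𝒮 K =>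
        ∑ s, weight P θ P₁ (obs ω) s * F (s, ω) :=
      Finset.measurable_sum _ fun s _ =>
        ((measurable_weight P θ P₁ s).comp measurable_obs).mul (hF.comp (by fun_prop))
    rw [law, referenceLaw, lintegral_map hF (by fun_prop), lintegral_fintype,
      lintegral_dirac' _ hm]
    simp [weight, mul_comm]
  | succ t ih =>
    have hs : ∀ s, Measurable fun ω : Fin (t + 1) → Round 𝒳 𝒮 K =>
        weight P θ P₁ (obs ω) s * F (s, ω) := fun s =>
      ((measurable_weight P θ P₁ s).comp measurable_obs).mul (hF.comp (by fun_prop))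
    have hp : Measurable fun p : (𝒮 × (Fin t → Round 𝒳 𝒮 K)) × Round 𝒳 𝒮 K =>
        F (p.1.1, Fin.snoc (α := fun _ => Round 𝒳 𝒮 K) p.1.2 p.2) :=
      hF.comp ((measurable_fst.comp measurable_fst).prodMk
        (measurable_snoc.comp ((measurable_snd.comp measurable_fst).prodMk measurable_snd)))
    rw [lintegral_law_succ P θ P₁ ctx select hselect t hF,
      lintegral_referenceLaw_succ P θ P₁ ctx select hselect t
        (Finset.measurable_sum _ fun s _ => hs s),
      ih hp.lintegral_kernel_prod_right']
    refine lintegral_congr fun ω => ?_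
    have hsn : ∀ s, Measurable fun q : Round 𝒳 𝒮 K =>
        weight P θ P₁ (obs (Fin.snoc (α := fun _ => Round 𝒳 𝒮 K) ω q :
          Fin (t + 1) → Round 𝒳 𝒮 K)) s * F (s, Fin.snoc (α := fun _ => Round 𝒳 𝒮 K) ω q) :=
      fun s => (hs s).comp (measurable_snoc_right ω)
    rw [lintegral_finsetSum _ fun s _ => hsn s]
    refine Finset.sum_congr rfl fun s _ => ?_
    have hq : Measurable fun q => F (s, Fin.snoc (α := fun _ => Round 𝒳 𝒮 K) ω q) :=
      hp.comp (by fun_prop : Measurable fun q : Round 𝒳 𝒮 K => ((s, ω), q))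
    have hlq : Measurable fun q : Round 𝒳 𝒮 K => likelihood P θ s (q.1, q.2.2.1, q.2.2.2) *
        F (s, Fin.snoc (α := fun _ => Round 𝒳 𝒮 K) ω q) :=
      ((measurable_likelihood P θ s).comp (by fun_prop)).mul hq
    rw [lintegral_stepKernel_eq_referenceStep P θ P₁ ctx select hselect t s ω hq,
      ← lintegral_const_mul _ hlq]
    refine lintegral_congr fun q => ?_
    rw [weight_obs_snoc, mul_assoc]

end
end
-- Suboptimality and total regret
section

variable {𝒳 𝒮 Θ : Type*} {K : ℕ} [MeasurableSpace 𝒳] [MeasurableSpace 𝒮]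

/-- The suboptimality of the action `a` in context `x` and latent state `s`. -/
noncomputable def suboptimality (P : Θ → Kernel (Fin K × 𝒳 × 𝒮) ℝ) (θ : Θ) (a : Fin K) (x : 𝒳)
    (s : 𝒮) : ℝ :=
  (⨆ a', meanReward P a' x s θ) - meanReward P a x s θ

lemma suboptimality_nonneg (P : Θ → Kernel (Fin K × 𝒳 × 𝒮) ℝ) (θ : Θ) (a : Fin K) (x : 𝒳)
    (s : 𝒮) : 0 ≤ suboptimality P θ a x s :=
  sub_nonneg.2 (le_ciSup (f := fun a' => meanReward P a' x s θ) (Set.finite_range _).bddAbove a)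

lemma suboptimality_le_one (P : Θ → Kernel (Fin K × 𝒳 × 𝒮) ℝ) (θ : Θ)
    (hgap : ∀ x s a a', meanReward P a' x s θ - meanReward P a x s θ ≤ 1) (a : Fin K) (x : 𝒳)
    (s : 𝒮) : suboptimality P θ a x s ≤ 1 := by
  have : Nonempty (Fin K) := ⟨a⟩
  have h : (⨆ a', meanReward P a' x s θ) ≤ 1 + meanReward P a x s θ :=
    ciSup_le fun a' => by linarith [hgap x s a a']
  unfold suboptimality
  linarith

lemma suboptimality_eq (P : Θ → Kernel (Fin K × 𝒳 × 𝒮) ℝ) (θ : Θ) {a₀ : Fin K} {x : 𝒳} {s : 𝒮}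
    (h : ∀ a, meanReward P a x s θ ≤ meanReward P a₀ x s θ) (a : Fin K) :
    suboptimality P θ a x s = meanReward P a₀ x s θ - meanReward P a x s θ := by
  have : Nonempty (Fin K) := ⟨a⟩
  unfold suboptimality
  rw [le_antisymm (ciSup_le h)
    (le_ciSup (f := fun a' => meanReward P a' x s θ) (Set.finite_range _).bddAbove a₀)]

lemma measurable_meanReward (P : Θ → Kernel (Fin K × 𝒳 × 𝒮) ℝ) (θ : Θ) :
    Measurable fun q : Fin K × 𝒳 × 𝒮 => meanReward P q.1 q.2.1 q.2.2 θ :=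
  (StronglyMeasurable.integral_kernel (κ := P θ) (f := fun r : ℝ => r)
    stronglyMeasurable_id).measurable

lemma measurable_suboptimality (P : Θ → Kernel (Fin K × 𝒳 × 𝒮) ℝ) (θ : Θ) :
    Measurable fun q : Fin K × 𝒳 × 𝒮 => suboptimality P θ q.1 q.2.1 q.2.2 := by
  have h := measurable_meanReward P θ
  refine Measurable.sub (Measurable.iSup fun a => ?_) h
  exact h.comp (by fun_prop : Measurable fun q : Fin K × 𝒳 × 𝒮 => (a, q.2.1, q.2.2))

lemma measurable_suboptimality_select (P : Θ → Kernel (Fin K × 𝒳 × 𝒮) ℝ) (θ : Θ)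
    {select : 𝒳 → 𝒮 → Fin K} (b s : 𝒮) (hselect : Measurable (Function.uncurry select)) :
    Measurable fun x => ENNReal.ofReal (suboptimality P θ (select x b) x s) := by
  have h : Measurable fun x => select x b :=
    hselect.comp (by fun_prop : Measurable fun x : 𝒳 => (x, b))
  exact ((measurable_suboptimality P θ).comp
    (by fun_prop : Measurable fun x => (select x b, x, s))).ennreal_ofReal

lemma totalRegret_eq (P : Θ → Kernel (Fin K × 𝒳 × 𝒮) ℝ) (θ : Θ) {n : ℕ}
    (p : 𝒮 × (Fin n → Round 𝒳 𝒮 K)) :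
    totalRegret P θ p = ∑ t, suboptimality P θ (p.2 t).2.2.1 (p.2 t).1 p.1 := rfl

lemma measurable_totalRegret (P : Θ → Kernel (Fin K × 𝒳 × 𝒮) ℝ) (θ : Θ) {n : ℕ} :
    Measurable (totalRegret (n := n) P θ) := by
  refine Finset.measurable_sum _ fun t _ => ?_
  exact (measurable_suboptimality P θ).comp (by fun_prop :
    Measurable fun p : 𝒮 × (Fin n → Round 𝒳 𝒮 K) => ((p.2 t).2.2.1, (p.2 t).1, p.1))

lemma totalRegret_nonneg (P : Θ → Kernel (Fin K × 𝒳 × 𝒮) ℝ) (θ : Θ) {n : ℕ}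
    (p : 𝒮 × (Fin n → Round 𝒳 𝒮 K)) : 0 ≤ totalRegret P θ p :=
  Finset.sum_nonneg fun _ _ => suboptimality_nonneg P θ _ _ _

lemma totalRegret_le (P : Θ → Kernel (Fin K × 𝒳 × 𝒮) ℝ) (θ : Θ)
    (hgap : ∀ x s a a', meanReward P a' x s θ - meanReward P a x s θ ≤ 1) {n : ℕ}
    (p : 𝒮 × (Fin n → Round 𝒳 𝒮 K)) : totalRegret P θ p ≤ n := by
  rw [totalRegret_eq]
  refine (Finset.sum_le_sum fun t _ => suboptimality_le_one P θ hgap _ _ _).trans ?_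
  simp

lemma totalRegret_snoc (P : Θ → Kernel (Fin K × 𝒳 × 𝒮) ℝ) (θ : Θ) {t : ℕ} (s : 𝒮)
    (ω : Fin t → Round 𝒳 𝒮 K) (q : Round 𝒳 𝒮 K) :
    totalRegret P θ (s, (Fin.snoc (α := fun _ => Round 𝒳 𝒮 K) ω q : Fin (t + 1) → Round 𝒳 𝒮 K)) =
      totalRegret P θ (s, ω) + suboptimality P θ q.2.2.1 q.1 s := by
  simp [totalRegret_eq, Fin.sum_univ_castSucc]

end

/-! ### The potential -/

/-- The potential `∑ s b, w s ^ (1 - α) * w b ^ α` of a vector of weights. -/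
noncomputable def potential {𝒮 : Type*} [Fintype 𝒮] (α : ℝ) (w : 𝒮 → ℝ≥0∞) : ℝ≥0∞ :=
  ∑ s, ∑ b, w s ^ (1 - α) * w b ^ α

lemma measurable_potential_weight {𝒳 𝒮 Θ : Type*} {K : ℕ} [MeasurableSpace 𝒳]
    [MeasurableSpace 𝒮] [Fintype 𝒮] (P : Θ → Kernel (Fin K × 𝒳 × 𝒮) ℝ) (θ : Θ)
    (P₁ : Measure 𝒮) (α : ℝ) (t : ℕ) :
    Measurable fun ω : Fin t → Round 𝒳 𝒮 K => potential α (weight P θ P₁ (obs ω)) := by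
  have h : ∀ s, Measurable fun ω : Fin t → Round 𝒳 𝒮 K => weight P θ P₁ (obs ω) s := fun s =>
    (measurable_weight P θ P₁ s).comp measurable_obs
  unfold potential
  exact Finset.measurable_sum _ fun s _ => Finset.measurable_sum _ fun b _ =>
    ((h s).pow_const _).mul ((h b).pow_const _)

/-- Weighted AM-GM bounds each term by `(1 - α) * P₁ {s} + α * P₁ {b}`, and these sum to `|𝒮|`. -/
lemma lintegral_potential_zero_le {𝒳 𝒮 Θ : Type*} {K : ℕ} [MeasurableSpace 𝒳]
    [MeasurableSpace 𝒮] [Fintype 𝒮] [MeasurableSingletonClass 𝒮]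
    (P : Θ → Kernel (Fin K × 𝒳 × 𝒮) ℝ) (θ : Θ) (P₁ : Measure 𝒮) [IsProbabilityMeasure P₁]
    (ctx : (t : ℕ) → Kernel (Hist 𝒳 K t) 𝒳) (select : 𝒳 → 𝒮 → Fin K)
    (hselect : Measurable (Function.uncurry select)) {α : ℝ} (hα : 0 < α) (hα1 : α < 1) :
    ∫⁻ ω, potential α (weight P θ P₁ (obs ω)) ∂(referenceLaw P θ P₁ ctx select hselect 0) ≤
      Fintype.card 𝒮 := by
  rw [referenceLaw, lintegral_dirac' _ (measurable_potential_weight P θ P₁ α 0)]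
  have hα1' : 0 ≤ 1 - α := by linarith
  have hp1 : ∑ s, P₁ {s} = 1 := by simp
  simp only [potential, weight, Finset.univ_eq_empty, Finset.prod_empty, mul_one]
  have h : ∀ s b, P₁ {s} ^ (1 - α) * P₁ {b} ^ α ≤
      ENNReal.ofReal (1 - α) * P₁ {s} + ENNReal.ofReal α * P₁ {b} := by
    intro s b
    have hw : (⟨1 - α, hα1'⟩ : ℝ≥0) + ⟨α, hα.le⟩ = 1 := NNReal.eq (sub_add_cancel 1 α)
    have := NNReal.geom_mean_le_arith_mean2_weighted ⟨1 - α, hα1'⟩ ⟨α, hα.le⟩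
      (P₁ {s}).toNNReal (P₁ {b}).toNNReal hw
    rw [← ENNReal.coe_toNNReal (measure_ne_top P₁ {s}), ← ENNReal.coe_toNNReal
      (measure_ne_top P₁ {b}), ENNReal.ofReal_eq_coe_nnreal hα1', ENNReal.ofReal_eq_coe_nnreal hα.le,
      ← ENNReal.coe_rpow_of_nonneg _ hα1', ← ENNReal.coe_rpow_of_nonneg _ hα.le]
    exact_mod_cast this
  calc ∑ s, ∑ b, P₁ {s} ^ (1 - α) * P₁ {b} ^ α
      ≤ ∑ s, ∑ b, (ENNReal.ofReal (1 - α) * P₁ {s} + ENNReal.ofReal α * P₁ {b}) :=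
        Finset.sum_le_sum fun s _ => Finset.sum_le_sum fun b _ => h s b
    _ = (ENNReal.ofReal (1 - α) + ENNReal.ofReal α) * Fintype.card 𝒮 := by
        simp only [Finset.sum_add_distrib, ← Finset.mul_sum, hp1, Finset.sum_const,
          Finset.card_univ, nsmul_eq_mul]
        ring
    _ = Fintype.card 𝒮 := by
        rw [← ENNReal.ofReal_add hα1' hα.le]; simp

/-- `posterior_sampling_step` for probability masses in `ℝ≥0∞`. -/
lemma posterior_sampling_step_ennreal {𝒮 ι : Type*} [Fintype 𝒮] (p : 𝒮 → ℝ≥0∞) (hp1 : ∑ s, p s = 1)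
    (m : ι → 𝒮 → ℝ) (sel : 𝒮 → ι) (hmax : ∀ s i, m i s ≤ m (sel s) s)
    (hgap : ∀ s i j, m i s - m j s ≤ 1)
    (bc : ι → 𝒮 → 𝒮 → ℝ≥0∞) (hbc1 : ∀ i s b, bc i s b ≤ 1)
    {α θ A V : ℝ} (hα : 0 < α) (hα1 : α < 1) (hA : 0 < A) (hV : 0 ≤ V)
    (hbc : ∀ i s b, bc i s b ≤ ENNReal.ofReal (Real.exp (-((m i b - m i s) / A - V / A ^ 2)))) :
    ∑ s, ∑ b, p s * p b * ENNReal.ofReal (m (sel s) s - m (sel b) s) +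
      ENNReal.ofReal (Real.exp θ * (2 + A)) *
        ∑ s, ∑ b, p s ^ (1 - α) * p b ^ α * ∑ c, p c * bc (sel c) s b ≤
    ENNReal.ofReal (Real.exp θ * (2 + A)) * ∑ s, ∑ b, p s ^ (1 - α) * p b ^ α +
      ENNReal.ofReal (V / A + 2 * Real.exp (-(θ / α)) * (Fintype.card 𝒮 - 1)) := by
  classical
  have hα1' : 0 ≤ 1 - α := by linarith
  have hple : ∀ s, p s ≤ 1 := fun s =>
    hp1 ▸ Finset.single_le_sum (fun _ _ => zero_le) (Finset.mem_univ s)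
  lift p to 𝒮 → ℝ≥0 using fun s => ((hple s).trans_lt ENNReal.one_lt_top).ne
  have hbct : ∀ i s b, bc i s b ≠ ∞ := fun i s b =>
    ((hbc1 i s b).trans_lt ENNReal.one_lt_top).ne
  obtain ⟨β, rfl⟩ : ∃ β : ι → 𝒮 → 𝒮 → ℝ≥0, bc = fun i s b => (β i s b : ℝ≥0∞) :=
    ⟨fun i s b => (bc i s b).toNNReal, by
      funext i s b; exact (ENNReal.coe_toNNReal (hbct i s b)).symm⟩
  beta_reduce at hp1 hbc1 hbc ⊢
  -- Total mass one forces `𝒮` to be nonempty, so the additive constant is nonnegative and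
  -- `ENNReal.ofReal` does not truncate it.
  have hcard : (0 : ℝ) ≤ Fintype.card 𝒮 - 1 := by
    have : Nonempty 𝒮 := by
      by_contra h
      rw [not_nonempty_iff] at h
      simp at hp1
    have : 1 ≤ Fintype.card 𝒮 := Fintype.card_pos
    rw [sub_nonneg]; exact_mod_cast this
  have key := posterior_sampling_step (θ := θ) (fun s => (p s : ℝ)) (fun s => (p s).2)
    (by exact_mod_cast hp1) m sel hgap (fun i s b => (β i s b : ℝ)) (fun i s b => (β i s b).2)
    (fun i s b => by exact_mod_cast hbc1 i s b) hα hα1 hA hV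
    (fun i s b => by
      have := ENNReal.toReal_mono ENNReal.ofReal_ne_top (hbc i s b)
      rwa [ENNReal.toReal_ofReal (Real.exp_pos _).le] at this)
  set C := Real.exp θ * (2 + A) with hC
  have hC0 : 0 ≤ C := by positivity
  have hg : ∀ s b, 0 ≤ m (sel s) s - m (sel b) s := fun s b => sub_nonneg.2 (hmax s (sel b))
  set g : 𝒮 → 𝒮 → ℝ≥0 := fun s b => ⟨m (sel s) s - m (sel b) s, hg s b⟩ with hgdef
  have hg1 : ∀ s b, ENNReal.ofReal (m (sel s) s - m (sel b) s) = (g s b : ℝ≥0∞) :=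
    fun s b => ENNReal.ofReal_eq_coe_nnreal (hg s b)
  have hg2 : ∀ s b, m (sel s) s - m (sel b) s = (g s b : ℝ) := fun _ _ => rfl
  have hD : 0 ≤ V / A + 2 * Real.exp (-(θ / α)) * (Fintype.card 𝒮 - 1) := by positivity
  simp only [hg2] at key
  simp only [hg1]
  lift C to ℝ≥0 using hC0 with C'
  lift V / A + 2 * Real.exp (-(θ / α)) * (Fintype.card 𝒮 - 1) to ℝ≥0 using hD with D'
  simp only [ENNReal.ofReal_coe_nnreal, ← ENNReal.coe_rpow_of_nonneg _ hα1',
    ← ENNReal.coe_rpow_of_nonneg _ hα.le]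
  simp only [← NNReal.coe_rpow] at key
  exact_mod_cast key

/-! ### Telescoping the regret against the potential -/

section

variable {𝒳 𝒮 Θ : Type*} {K : ℕ} [MeasurableSpace 𝒳] [MeasurableSpace 𝒮] [Fintype 𝒮]
  [MeasurableSingletonClass 𝒮]

/-- The fallback to the prior is harmless at zero evidence, where both sides vanish. Infinite
evidence has to be excluded. -/
lemma weight_eq_evidence_mul (P : Θ → Kernel (Fin K × 𝒳 × 𝒮) ℝ) (θ : Θ) (P₁ : Measure 𝒮) {t : ℕ}
    {h : Hist 𝒳 K t} (hE : evidence P θ P₁ h ≠ ∞) (s : 𝒮) :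
    weight P θ P₁ h s = evidence P θ P₁ h * posteriorMeasure P θ P₁ h {s} := by
  classical
  by_cases h0 : evidence P θ P₁ h = 0
  · rw [h0, zero_mul]
    exact Finset.sum_eq_zero_iff.1 h0 s (Finset.mem_univ s)
  · have : posteriorMeasure P θ P₁ h {s} = weight P θ P₁ h s / evidence P θ P₁ h := by
      rw [posteriorMeasure, if_neg (by tauto)]
      simp only [Measure.coe_finsetSum, Finset.sum_apply, Measure.smul_apply, smul_eq_mul]
      rw [Finset.sum_eq_single s] <;> simp +contextual
    rw [this, ENNReal.mul_div_cancel h0 hE]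

section

variable (P : Θ → Kernel (Fin K × 𝒳 × 𝒮) ℝ) [∀ θ, IsMarkovKernel (P θ)] (θ : Θ)
    (P₁ : Measure 𝒮) [IsProbabilityMeasure P₁] (ctx : (t : ℕ) → Kernel (Hist 𝒳 K t) 𝒳)
    [∀ t, IsMarkovKernel (ctx t)]
    (select : 𝒳 → 𝒮 → Fin K) (hselect : Measurable (Function.uncurry select))

instance (t : ℕ) (h : Hist 𝒳 K t) : IsProbabilityMeasure (posteriorMeasure P θ P₁ h) :=
  inferInstanceAs (IsProbabilityMeasure (posteriorKernel P θ P₁ t h))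

/-- A new reward multiplies each weight by its likelihood, so integrating over the reward turns the
`(s, b)` term into itself times an affinity. -/
lemma lintegral_potential_snoc {α : ℝ} (hα : 0 < α) (hα1 : α < 1) (t : ℕ)
    (ω : Fin t → Round 𝒳 𝒮 K) :
    ∫⁻ q, potential α (weight P θ P₁ (obs (Fin.snoc (α := fun _ => Round 𝒳 𝒮 K) ω q :
        Fin (t + 1) → Round 𝒳 𝒮 K))) ∂(referenceStep P θ P₁ ctx select hselect t ω) =
      ∫⁻ x, ∑ s, ∑ b, weight P θ P₁ (obs ω) s ^ (1 - α) * weight P θ P₁ (obs ω) b ^ α *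
        ∑ c, posteriorMeasure P θ P₁ (obs ω) {c} * affinity P θ α x (select x c) s b
        ∂(ctx t (obs ω)) := by
  have hm : Measurable fun q : Round 𝒳 𝒮 K =>
      potential α (weight P θ P₁ (obs (Fin.snoc (α := fun _ => Round 𝒳 𝒮 K) ω q :
        Fin (t + 1) → Round 𝒳 𝒮 K))) :=
    (measurable_potential_weight P θ P₁ α (t + 1)).comp (measurable_snoc_right ω)
  rw [lintegral_referenceStep P θ P₁ ctx select hselect t ω hm]
  refine lintegral_congr fun x => ?_
  have hl : ∀ a s, Measurable fun r => likelihood P θ s (x, a, r) := fun a s =>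
    (measurable_likelihood P θ s).comp (by fun_prop)
  have hi : ∀ c, ∫⁻ r, potential α (weight P θ P₁ (obs (Fin.snoc (α := fun _ => Round 𝒳 𝒮 K) ω
      (x, c, select x c, r) : Fin (t + 1) → Round 𝒳 𝒮 K)))
      ∂(dominatingKernel P θ (select x c, x)) =
      ∑ s, ∑ b, weight P θ P₁ (obs ω) s ^ (1 - α) * weight P θ P₁ (obs ω) b ^ α *
        affinity P θ α x (select x c) s b := by
    intro c
    have hlm : ∀ s b, Measurable fun r => likelihood P θ s (x, select x c, r) ^ (1 - α) *
        likelihood P θ b (x, select x c, r) ^ α := fun s b =>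
      ((hl _ s).pow_const _).mul ((hl _ b).pow_const _)
    unfold potential affinity
    simp only [weight_obs_snoc, ENNReal.mul_rpow_of_nonneg _ _ hα.le,
      ENNReal.mul_rpow_of_nonneg _ _ (sub_nonneg.2 hα1.le), mul_mul_mul_comm]
    rw [lintegral_finsetSum _ fun s _ => Finset.measurable_sum _ fun b _ => (hlm s b).const_mul _]
    refine Finset.sum_congr rfl fun s _ => ?_
    rw [lintegral_finsetSum _ fun b _ => (hlm s b).const_mul _]
    exact Finset.sum_congr rfl fun b _ => lintegral_const_mul _ (hlm s b)
  simp only [hi, Finset.sum_mul, Finset.mul_sum]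
  rw [Finset.sum_comm]
  refine Finset.sum_congr rfl fun s _ => ?_
  rw [Finset.sum_comm]
  exact Finset.sum_congr rfl fun b _ => Finset.sum_congr rfl fun c _ => by ring

lemma lintegral_suboptimality_stepKernel (t : ℕ) (s : 𝒮) (ω : Fin t → Round 𝒳 𝒮 K) :
    ∫⁻ q, ENNReal.ofReal (suboptimality P θ q.2.2.1 q.1 s)
        ∂(stepKernel P θ θ P₁ ctx select hselect t (s, ω)) =
      ∫⁻ x, ∑ b, posteriorMeasure P θ P₁ (obs ω) {b} *
        ENNReal.ofReal (suboptimality P θ (select x b) x s) ∂(ctx t (obs ω)) := by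
  have hm : Measurable fun q : Round 𝒳 𝒮 K =>
      ENNReal.ofReal (suboptimality P θ q.2.2.1 q.1 s) :=
    ((measurable_suboptimality P θ).comp
      (by fun_prop : Measurable fun q : Round 𝒳 𝒮 K => (q.2.2.1, q.1, s))).ennreal_ofReal
  rw [lintegral_stepKernel P θ P₁ ctx select hselect t s ω hm]
  refine lintegral_congr fun x => Finset.sum_congr rfl fun b _ => ?_
  simp [mul_comm]

/-- The conditional regret of a round is at most the conditional decrease of the potential plus a
constant. -/
lemma regret_add_potential_le {c : ℝ≥0}
    (hσ : ∀ a x s, HasSubgaussianMGF (fun r => r - meanReward P a x s θ) c (P θ (a, x, s)))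
    (hgap : ∀ x s a a', meanReward P a' x s θ - meanReward P a x s θ ≤ 1)
    (hmax : ∀ x b a, meanReward P a x b θ ≤ meanReward P (select x b) x b θ)
    {α τ A : ℝ} (hα : 0 < α) (hα1 : α < 1) (hA : 0 < A) (t : ℕ) (ω : Fin t → Round 𝒳 𝒮 K)
    (hE : evidence P θ P₁ (obs ω) ≠ ∞) :
    ∑ s, weight P θ P₁ (obs ω) s * ∫⁻ q, ENNReal.ofReal (suboptimality P θ q.2.2.1 q.1 s)
        ∂(stepKernel P θ θ P₁ ctx select hselect t (s, ω)) +
      ENNReal.ofReal (Real.exp τ * (2 + A)) *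
        ∫⁻ q, potential α (weight P θ P₁ (obs (Fin.snoc (α := fun _ => Round 𝒳 𝒮 K) ω q :
          Fin (t + 1) → Round 𝒳 𝒮 K))) ∂(referenceStep P θ P₁ ctx select hselect t ω) ≤
    ENNReal.ofReal (Real.exp τ * (2 + A)) * potential α (weight P θ P₁ (obs ω)) +
      ENNReal.ofReal (c / (2 * α * (1 - α)) / A +
        2 * Real.exp (-(τ / α)) * (Fintype.card 𝒮 - 1)) * evidence P θ P₁ (obs ω) := by
  have hα1' : 0 < 1 - α := by linarith
  rw [lintegral_potential_snoc P θ P₁ ctx select hselect hα hα1]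
  simp only [lintegral_suboptimality_stepKernel P θ P₁ ctx select hselect, potential,
    weight_eq_evidence_mul P θ P₁ hE]
  set E := evidence P θ P₁ (obs ω)
  set p : 𝒮 → ℝ≥0∞ := fun s => posteriorMeasure P θ P₁ (obs ω) {s} with hp
  have hp1 : ∑ s, p s = 1 := by simp [hp]
  -- Homogeneity of degree one: the exponents `1 - α` and `α` add up to `1`, so the evidence factors
  -- out.
  have hpow : ∀ s b, (E * p s) ^ (1 - α) * (E * p b) ^ α = E * (p s ^ (1 - α) * p b ^ α) := by
    intro s b
    rw [ENNReal.mul_rpow_of_nonneg _ _ hα.le, ENNReal.mul_rpow_of_nonneg _ _ hα1'.le,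
      mul_mul_mul_comm, ← ENNReal.rpow_add_of_nonneg _ _ hα1'.le hα.le, sub_add_cancel,
      ENNReal.rpow_one]
  have hms : ∀ s, Measurable fun x => ∑ b, p b *
      ENNReal.ofReal (suboptimality P θ (select x b) x s) := fun s =>
    Finset.measurable_sum _ fun b _ =>
      (measurable_suboptimality_select P θ b s hselect).const_mul _
  change ∑ s, E * p s * ∫⁻ x, ∑ b, p b * ENNReal.ofReal (suboptimality P θ (select x b) x s)
      ∂(ctx t (obs ω)) + ENNReal.ofReal (Real.exp τ * (2 + A)) * ∫⁻ x, ∑ s, ∑ b,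
      (E * p s) ^ (1 - α) * (E * p b) ^ α * ∑ c, p c * affinity P θ α x (select x c) s b
      ∂(ctx t (obs ω)) ≤ ENNReal.ofReal (Real.exp τ * (2 + A)) *
      ∑ s, ∑ b, (E * p s) ^ (1 - α) * (E * p b) ^ α + _
  simp only [hpow]
  have hpt : ∀ x, ∑ s, E * p s * (∑ b, p b * ENNReal.ofReal (suboptimality P θ (select x b) x s)) +
      ENNReal.ofReal (Real.exp τ * (2 + A)) * ∑ s, ∑ b,
        E * (p s ^ (1 - α) * p b ^ α) * ∑ c, p c * affinity P θ α x (select x c) s b ≤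
      ENNReal.ofReal (Real.exp τ * (2 + A)) * ∑ s, ∑ b, E * (p s ^ (1 - α) * p b ^ α) +
      ENNReal.ofReal (c / (2 * α * (1 - α)) / A +
        2 * Real.exp (-(τ / α)) * (Fintype.card 𝒮 - 1)) * E := by
    intro x
    have h := posterior_sampling_step_ennreal (θ := τ) p hp1 (fun a s => meanReward P a x s θ)
      (fun b => select x b) (fun s a => hmax x s a) (fun s a a' => hgap x s a' a)
      (fun a s b => affinity P θ α x a s b)
      (fun a s b => affinity_le_one P θ hσ hα hα1 x a s b) hα hα1 hA
      (V := c / (2 * α * (1 - α))) (by positivity) (fun a s b => by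
        -- The tilt `l = A⁻¹` produces the exponent `gap / A - V / A ^ 2`.
        refine (affinity_le P θ hσ hα hα1 x a s b A⁻¹).trans_eq ?_
        congr 3
        field_simp)
    have h2 := mul_le_mul_right h E
    refine le_trans (le_of_eq ?_) (h2.trans (le_of_eq ?_))
    · rw [mul_add E]
      congr 1
      · simp only [Finset.mul_sum]
        refine Finset.sum_congr rfl fun s _ => Finset.sum_congr rfl fun b _ => ?_
        rw [suboptimality_eq P θ (hmax x s)]
        ring
      · simp only [Finset.mul_sum]
        refine Finset.sum_congr rfl fun s _ => Finset.sum_congr rfl fun b _ =>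
          Finset.sum_congr rfl fun c _ => ?_
        ring
    · rw [mul_add E, mul_comm E (ENNReal.ofReal (_ / A + _))]
      congr 1
      simp only [Finset.mul_sum]
      refine Finset.sum_congr rfl fun s _ => Finset.sum_congr rfl fun b _ => ?_
      ring
  have h1 : ∑ s, E * p s * ∫⁻ x, ∑ b, p b * ENNReal.ofReal (suboptimality P θ (select x b) x s)
      ∂(ctx t (obs ω)) = ∫⁻ x, ∑ s, E * p s *
        (∑ b, p b * ENNReal.ofReal (suboptimality P θ (select x b) x s)) ∂(ctx t (obs ω)) := by
    rw [lintegral_finsetSum _ fun s _ => (hms s).const_mul _]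
    exact Finset.sum_congr rfl fun s _ => (lintegral_const_mul _ (hms s)).symm
  rw [h1, ← lintegral_const_mul' _ _ ENNReal.ofReal_ne_top,
    ← lintegral_add_left (Finset.measurable_sum _ fun s _ => (hms s).const_mul _)]
  refine (lintegral_mono hpt).trans ?_
  simp

/-- The evidence is the density of the law of the records, hence finite almost everywhere under the
reference law, as `weight_eq_evidence_mul` requires. -/
lemma lintegral_evidence (t : ℕ) :
    ∫⁻ ω, evidence P θ P₁ (obs ω) ∂(referenceLaw P θ P₁ ctx select hselect t) = 1 := by
  have := lintegral_law P θ P₁ ctx select hselect t (F := fun _ => 1) measurable_const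
  simpa [evidence] using this.symm

lemma lintegral_totalRegret_add_potential_le {c : ℝ≥0}
    (hσ : ∀ a x s, HasSubgaussianMGF (fun r => r - meanReward P a x s θ) c (P θ (a, x, s)))
    (hgap : ∀ x s a a', meanReward P a' x s θ - meanReward P a x s θ ≤ 1)
    (hmax : ∀ x b a, meanReward P a x b θ ≤ meanReward P (select x b) x b θ)
    {α τ A : ℝ} (hα : 0 < α) (hα1 : α < 1) (hA : 0 < A) (t : ℕ) :
    ∫⁻ p, ENNReal.ofReal (totalRegret P θ p) ∂(law P θ θ P₁ ctx select hselect t) +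
      ENNReal.ofReal (Real.exp τ * (2 + A)) * ∫⁻ ω, potential α (weight P θ P₁ (obs ω))
        ∂(referenceLaw P θ P₁ ctx select hselect t) ≤
    ENNReal.ofReal (Real.exp τ * (2 + A)) * Fintype.card 𝒮 +
      t * ENNReal.ofReal (c / (2 * α * (1 - α)) / A +
        2 * Real.exp (-(τ / α)) * (Fintype.card 𝒮 - 1)) := by
  induction t with
  | zero =>
    have := lintegral_potential_zero_le P θ P₁ ctx select hselect hα hα1
    simp only [totalRegret_eq, Finset.univ_eq_empty, Finset.sum_empty, ENNReal.ofReal_zero,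
      lintegral_const, zero_mul, zero_add, Nat.cast_zero, add_zero]
    gcongr
  | succ t ih =>
    set C := ENNReal.ofReal (Real.exp τ * (2 + A))
    set D := ENNReal.ofReal (c / (2 * α * (1 - α)) / A +
        2 * Real.exp (-(τ / α)) * (Fintype.card 𝒮 - 1))
    have hTm : ∀ t, Measurable fun p : 𝒮 × (Fin t → Round 𝒳 𝒮 K) =>
        ENNReal.ofReal (totalRegret P θ p) := fun t => (measurable_totalRegret P θ).ennreal_ofReal
    have hsm : Measurable fun r : (𝒮 × (Fin t → Round 𝒳 𝒮 K)) × Round 𝒳 𝒮 K =>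
        ENNReal.ofReal (suboptimality P θ r.2.2.2.1 r.2.1 r.1.1) :=
      ((measurable_suboptimality P θ).comp (by fun_prop : Measurable
        fun r : (𝒮 × (Fin t → Round 𝒳 𝒮 K)) × Round 𝒳 𝒮 K =>
          (r.2.2.2.1, r.2.1, r.1.1))).ennreal_ofReal
    have hR : ∫⁻ p, ENNReal.ofReal (totalRegret P θ p)
        ∂(law P θ θ P₁ ctx select hselect (t + 1)) =
        ∫⁻ p, ENNReal.ofReal (totalRegret P θ p) ∂(law P θ θ P₁ ctx select hselect t) +
        ∫⁻ ω, ∑ s, weight P θ P₁ (obs ω) s *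
          ∫⁻ q, ENNReal.ofReal (suboptimality P θ q.2.2.1 q.1 s)
            ∂(stepKernel P θ θ P₁ ctx select hselect t (s, ω))
          ∂(referenceLaw P θ P₁ ctx select hselect t) := by
      rw [← lintegral_law P θ P₁ ctx select hselect t
        (F := fun p => ∫⁻ q, ENNReal.ofReal (suboptimality P θ q.2.2.1 q.1 p.1)
            ∂(stepKernel P θ θ P₁ ctx select hselect t p)) hsm.lintegral_kernel_prod_right',
        ← lintegral_add_left (hTm t), lintegral_law_succ P θ P₁ ctx select hselect t (hTm _)]
      refine lintegral_congr fun p => ?_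
      simp only [totalRegret_snoc, ENNReal.ofReal_add (totalRegret_nonneg P θ _)
        (suboptimality_nonneg P θ _ _ _)]
      rw [lintegral_add_left measurable_const]
      simp
    have hEm : Measurable fun ω : Fin t → Round 𝒳 𝒮 K => evidence P θ P₁ (obs ω) :=
      (measurable_evidence P θ P₁).comp measurable_obs
    have hEae : ∀ᵐ ω ∂(referenceLaw P θ P₁ ctx select hselect t),
        evidence P θ P₁ (obs ω) ≠ ∞ := by
      filter_upwards [ae_lt_top hEm (by
        rw [lintegral_evidence P θ P₁ ctx select hselect t]; simp)] with ω h using h.ne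
    have hle := lintegral_mono_ae (hEae.mono fun ω h =>
      regret_add_potential_le P θ P₁ ctx select hselect hσ hgap hmax (τ := τ) hα hα1 hA t ω h)
    have hWm : Measurable fun ω : Fin t → Round 𝒳 𝒮 K => ∑ s, weight P θ P₁ (obs ω) s *
          ∫⁻ q, ENNReal.ofReal (suboptimality P θ q.2.2.1 q.1 s)
            ∂(stepKernel P θ θ P₁ ctx select hselect t (s, ω)) := by
      refine Finset.measurable_sum _ fun s _ =>
        ((measurable_weight P θ P₁ s).comp measurable_obs).mul ?_
      exact (hsm.lintegral_kernel_prod_right' (κ := stepKernel P θ θ P₁ ctx select hselect t)).comp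
        (by fun_prop : Measurable fun ω : Fin t → Round 𝒳 𝒮 K => (s, ω))
    rw [lintegral_add_left hWm, lintegral_const_mul' _ _ ENNReal.ofReal_ne_top,
      ← lintegral_referenceLaw_succ P θ P₁ ctx select hselect t
        (measurable_potential_weight P θ P₁ α (t + 1)),
      lintegral_add_left ((measurable_potential_weight P θ P₁ α t).const_mul _),
      lintegral_const_mul' _ _ ENNReal.ofReal_ne_top,
      lintegral_const_mul' _ _ ENNReal.ofReal_ne_top,
      lintegral_evidence P θ P₁ ctx select hselect t, mul_one] at hle
    rw [hR, add_assoc]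
    refine (add_le_add le_rfl hle).trans ?_
    rw [← add_assoc]
    refine (add_le_add ih le_rfl).trans_eq ?_
    push_cast
    ring

end
end
-- Choice of the constants
lemma one_le_log {x : ℝ} (hx : 4 ≤ x) : 1 ≤ Real.log x := by
  rw [Real.le_log_iff_exp_le (by linarith)]
  linarith [Real.exp_one_lt_d9]

lemma exp_quarter_le : Real.exp (1 / 4) ≤ 1.285 := by
  have h : Real.exp (1 / 4) ^ 4 = Real.exp 1 := by
    rw [← Real.exp_nat_mul]; norm_num
  refine le_of_pow_le_pow_left₀ (n := 4) (by norm_num) (by norm_num) ?_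
  rw [h]
  refine Real.exp_one_lt_d9.le.trans ?_
  norm_num

lemma regret_bound_of_forall_pos {r m n σ : ℝ} (hm : 1 ≤ m) (hn : 3 * m < n) (hn4 : 4 ≤ n) (hσ : 0 ≤ σ)
    (h : ∀ A > 0, r ≤ Real.exp (1 / 4) * (2 + A) * m +
      n * (σ ^ 2 / (2 * (1 / (8 * Real.log n)) * (1 - 1 / (8 * Real.log n))) / A +
        2 * Real.exp (-(1 / 4 / (1 / (8 * Real.log n)))) * (m - 1))) :
    r ≤ 3 * m + 2 * σ * √(6 * m * n * Real.log n) := by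
  have hL := one_le_log hn4
  set L := Real.log n with hLdef
  have hL0 : 0 < L := by linarith
  have hn0 : 0 < n := by linarith
  set V := σ ^ 2 / (2 * (1 / (8 * L)) * (1 - 1 / (8 * L))) with hV
  have h8 : 1 / (8 * L) ≤ 1 / 8 := by
    gcongr
    linarith
  -- Here `α = 1 / (8 * L) ≤ 1 / 8`, so `1 / (2 * α) = 4 * L` and `1 / (1 - α) ≤ 8 / 7`.
  have hVle : V ≤ 32 / 7 * L * σ ^ 2 := by
    have hpos : 0 < 1 / (8 * L) := by positivity
    rw [hV, div_le_iff₀ (by nlinarith)]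
    have : 1 ≤ 32 / 7 * L * (2 * (1 / (8 * L)) * (1 - 1 / (8 * L))) := by
      have e : 32 / 7 * L * (2 * (1 / (8 * L)) * (1 - 1 / (8 * L))) =
          8 / 7 * (1 - 1 / (8 * L)) := by field_simp; norm_num
      rw [e]; linarith
    nlinarith [mul_le_mul_of_nonneg_left this (sq_nonneg σ)]
  have hV0 : 0 ≤ V := by
    have : 0 ≤ 1 - 1 / (8 * L) := by linarith
    positivity
  have hexp : Real.exp (-(1 / 4 / (1 / (8 * L)))) = 1 / n ^ 2 := by
    have : -(1 / 4 / (1 / (8 * L))) = -(L + L) := by field_simp; norm_num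
    rw [this, Real.exp_neg, Real.exp_add, hLdef, Real.exp_log hn0]
    field_simp
  rw [hexp] at h
  set e := Real.exp (1 / 4) with he
  have he0 : 0 < e := Real.exp_pos _
  have hele : e ≤ 1.285 := exp_quarter_le
  have h1 := le_add_two_sqrt_of_forall_pos (r := r) (C := 2 * e * m + 2 / n * (m - 1))
    (a := e * m) (b := n * V) (by positivity) (by positivity) fun A hA => by
      refine (h A hA).trans_eq ?_
      field_simp
      ring
  -- The budget is `2 * 1.285 + 0.43 = 3`.
  have h2 : 2 * e * m + 2 / n * (m - 1) ≤ 3 * m := by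
    have h3 : 2 / n * (m - 1) ≤ 0.43 * m := by
      rw [div_mul_eq_mul_div, div_le_iff₀ hn0]
      nlinarith [sq_nonneg (m - 1)]
    nlinarith
  -- The constant `6` comes from `1.285 * 32 / 7 < 6`.
  have h3 : √(e * m * (n * V)) ≤ σ * √(6 * m * n * L) := by
    rw [← Real.sqrt_sq hσ, ← Real.sqrt_mul (sq_nonneg σ)]
    refine Real.sqrt_le_sqrt ?_
    calc e * m * (n * V) ≤ 1.285 * m * (n * (32 / 7 * L * σ ^ 2)) := by gcongr
      _ ≤ σ ^ 2 * (6 * m * n * L) := by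
        have : 0 ≤ σ ^ 2 * (m * n * L) := by positivity
        nlinarith
  linarith

end LatentBandit

/-! ### The regret bound -/

theorem corollary1 {𝒳 𝒮 Θ : Type*} [MeasurableSpace 𝒳]
    [Fintype 𝒮] [MeasurableSpace 𝒮] [MeasurableSingletonClass 𝒮] {K : ℕ}
    -- the conditional reward distributions `P(· ∣ a, x, s, θ)`
    (P : Θ → Kernel (Fin K × 𝒳 × 𝒮) ℝ) [∀ θ, IsMarkovKernel (P θ)]
    -- the model is known exactly
    (θstar θhat : Θ) (hθ : θhat = θstar)
    -- rewards are sub-Gaussian with variance proxy `σ ^ 2`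
    (σ : ℝ≥0)
    (hσ : ∀ a x s,
      HasSubgaussianMGF (fun r => r - LatentBandit.meanReward P a x s θstar) (σ ^ 2) (P θstar (a, x, s)))
    -- the suboptimality of any action is at most one
    (hgap : ∀ x s a a', LatentBandit.meanReward P a' x s θstar - LatentBandit.meanReward P a x s θstar ≤ 1)
    -- the prior over latent states
    (P₁ : Measure 𝒮) [IsProbabilityMeasure P₁]
    -- the process generating the contexts
    (ctx : (t : ℕ) → Kernel (LatentBandit.Hist 𝒳 K t) 𝒳) [∀ t, IsMarkovKernel (ctx t)]
    -- the maximizing action chosen by the algorithm for a given context and sampled state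
    (select : 𝒳 → 𝒮 → Fin K) (hselect : Measurable (Function.uncurry select))
    (hmax : ∀ x b a, LatentBandit.meanReward P a x b θhat ≤ LatentBandit.meanReward P (select x b) x b θhat)
    (n : ℕ) :
    Integrable (LatentBandit.totalRegret P θstar)
        (LatentBandit.law P θstar θhat P₁ ctx select hselect n) ∧
      LatentBandit.bayesRegret P θstar θhat P₁ ctx select hselect n ≤
        3 * Fintype.card 𝒮 + 2 * σ * √(6 * Fintype.card 𝒮 * n * Real.log n) := by
  subst hθ
  have hmeas := (LatentBandit.measurable_totalRegret (n := n) P θhat)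
  have hint : Integrable (LatentBandit.totalRegret P θhat)
      (LatentBandit.law P θhat θhat P₁ ctx select hselect n) :=
    Integrable.of_bound hmeas.aestronglyMeasurable n (Filter.Eventually.of_forall fun p => by
      rw [Real.norm_of_nonneg (LatentBandit.totalRegret_nonneg P θhat p)]
      exact LatentBandit.totalRegret_le P θhat hgap p)
  refine ⟨hint, ?_⟩
  have hm1 : 1 ≤ Fintype.card 𝒮 := by
    have : Nonempty 𝒮 := nonempty_of_isProbabilityMeasure P₁
    exact Fintype.card_pos
  -- For `n ≤ 3 * |𝒮|` regret at most one per round is enough. Otherwise `n ≥ 4`, so `log n ≥ 1` and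
  -- `α` is admissible.
  rcases le_or_gt n (3 * Fintype.card 𝒮) with hn | hn
  · have h1 : LatentBandit.bayesRegret P θhat θhat P₁ ctx select hselect n ≤ n := by
      refine (integral_mono hint (integrable_const (n : ℝ))
        fun p => LatentBandit.totalRegret_le P θhat hgap p).trans ?_
      simp
    have h2 : (n : ℝ) ≤ 3 * Fintype.card 𝒮 := by exact_mod_cast hn
    have h3 : 0 ≤ 2 * σ * √(6 * Fintype.card 𝒮 * n * Real.log n) := by positivity
    linarith
  · have hn4 : (4 : ℝ) ≤ n := by exact_mod_cast (by lia : 4 ≤ n)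
    refine LatentBandit.regret_bound_of_forall_pos (by exact_mod_cast hm1) (by exact_mod_cast hn) hn4
      σ.2 fun A hA => ?_
    have hL := LatentBandit.one_le_log hn4
    have hα : 0 < 1 / (8 * Real.log n) := by positivity
    have hα1 : 1 / (8 * Real.log n) < 1 := by
      rw [div_lt_one (by positivity)]; linarith
    have h := LatentBandit.lintegral_totalRegret_add_potential_le P θhat P₁ ctx select hselect hσ
      hgap hmax (τ := 1 / 4) hα hα1 hA n
    have hm1' : (0 : ℝ) ≤ Fintype.card 𝒮 - 1 := sub_nonneg.2 (by exact_mod_cast hm1)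
    have hα1' : 0 < 1 - 1 / (8 * Real.log n) := by linarith
    rw [LatentBandit.bayesRegret, integral_eq_lintegral_of_nonneg_ae
      (Filter.Eventually.of_forall (LatentBandit.totalRegret_nonneg P θhat))
      hmeas.aestronglyMeasurable]
    -- `le_self_add` discards the final potential.
    refine ENNReal.toReal_le_of_le_ofReal (by positivity) ((le_self_add.trans h).trans_eq ?_)
    symm
    rw [ENNReal.ofReal_add (by positivity) (by positivity),
      ENNReal.ofReal_mul (p := Real.exp (1 / 4) * (2 + A)) (by positivity),
      ENNReal.ofReal_mul (p := (n : ℝ)) (by positivity), ENNReal.ofReal_natCast,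
      ENNReal.ofReal_natCast, NNReal.coe_pow]
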